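/- **Notation.** $\langle i\rangle=\max\{1,|i|\}$, $\lfloor j\rfloor=\max\{2,|j|\}$. For $q>1$, $\mathtt w_q$ is the space of sequences $u=(u_j)_{j\in\mathbb Z}$ with $|u|_q=\sup_j|u_j|\lfloor j\rfloor^q<\infty$. *Tangential sites.* Let $i_*\ge 21$, $1<\eta\le 2$. An admissible sequence is a smooth strictly increasing $s:[0,\infty)\to[0,\infty)$ with $s(\mathbb N)\subset\mathbb N$ such that, for all real $i,i'\ge i_*$ and $h\ge1$: $s(i)\ge e^{(\log i)^{1+\eta}}$, $s(i+i')\ge s(i)+s(i')$, $s(hi)\ge h\,s(i)$, $s(i^2)\ge s(i)^2$. Let $\mathcal S\subset\mathbb Z$ be one of $\mathcal S_2\cup\mathcal S_0$, $(-\mathcal S_1)\cup\mathcal S_0$, $(-\mathcal S_1)\cup\mathcal S_2\cup\mathcal S_0$, with $\mathcal S_0$ finite (possibly empty) and $\mathcal S_k=s_k(\mathbb N)$, $s_1,s_2$ admissible sequences with the same $i_*,\eta$. The index of a site is $i(s)=n$ if $s=-s_1(n)$ or $s=s_2(n)$ and $s\notin\mathcal S_0$; on $\mathcal S_0$ the index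 takes arbitrary values in $\mathbb N$. Put $\mathcal S^c=\mathbb Z\setminus\mathcal S$. *Frequencies.* For $\gamma>0$, $\mathtt D_{\gamma,\mathcal S}$ is the set of $\omega\in\mathbb R^{\mathbb Z}$ with $|\omega_j-j^2|<\frac12$ for all $j$ and $$|\omega\cdot\ell|\ge\gamma\prod_{s\in\mathcal S}\frac1{(1+|\ell_s|^2\langle i(s)\rangle^2)^{3/2}}$$ for all finitely supported $\ell\in\mathbb Z^{\mathbb Z}\setminus\{0\}$ with $\sum_{j\in\mathcal S^c}|\ell_j|\le2$ and $\sum_j j\ell_j=\sum_j\ell_j=0$. *Actions.* $\mathcal I(p,r)$ is the set of $I\in\mathtt w_{2p}$ with $|I|_{2p}<r^2$, $I_j=0$ for $j\in\mathcal S^c$ and $I_j\ge0$ for $j\in\mathcal S$; $\mathcal I(p,r,\mathbb C)$ is the set of complex $I\in\mathtt w_{2p}$ with $|I|_{2p}<r^2$ and $I_j=0$ for $j\in\mathcal S^c$. *Hamiltonians.* Let $\mathcal M$ be the set of pairs of finitely supported $\boldsymbol\alpha,\boldsymbol\beta\in\mathbb N^{\mathbb Z}$ with $|\boldsymbol\alpha|=|\boldsymbol\beta|$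 and $\sum_jj(\boldsymbol\alpha_j-\boldsymbol\beta_j)=0$. For a formal series $h=\sum_{\mathcal M}h_{\boldsymbol\alpha,\boldsymbol\beta}u^{\boldsymbol\alpha}\bar u^{\boldsymbol\beta}$ let $\underline h=\sum|h_{\boldsymbol\alpha,\boldsymbol\beta}|u^{\boldsymbol\alpha}\bar u^{\boldsymbol\beta}$ and $|h|_{r,p}=\frac1r\sup_{|u|_p\le r}|X_{\underline h}(u)|_p$, where $X_{\underline h}=(\mathrm i\,\partial_{\bar u_j}\underline h)_j$. It is real if $h_{\boldsymbol\alpha,\boldsymbol\beta}=\overline{h_{\boldsymbol\beta,\boldsymbol\alpha}}$. Let $\mathcal O=\mathtt D_{\gamma,\mathcal S}$, and let $\mathcal I=\mathcal I(p,r)$ (real case) or $\mathcal I=\mathcal I(p,r,\mathbb C)$ (complex case). For $f:\mathcal O\times\mathcal I\to\mathbb C$ put $$|f|^\gamma=\sup|f|+\gamma\sup_{\omega\ne\omega',\,I}\frac{|f(\omega,I)-f(\omega',I)|}{|\omega-\omega'|_\infty}.$$ Let $\mathcal F$ be the closure, for $|\cdot|^\gamma$ and inside the space of functions with $|f|^\gamma<\infty$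 that are continuous in $\omega$ for the product topology and analytic in $I$, of those that depend on finitely many $\omega_j$ only. For $p'\geq p$, $\mathcal H_{r,p'}$ is the space of families $H=H(\omega,I)$ of such series with $|H(\omega,I)|_{r,p'}<\infty$ for every $(\omega,I)$, with all $H_{\boldsymbol\alpha,\boldsymbol\beta}\in\mathcal F$, with $H(\omega,I)$ real for every $I\in\mathcal I(p,r)$, and with $\|H\|_{r,p'}:=\big|\sum|H_{\boldsymbol\alpha,\boldsymbol\beta}|^\gamma u^{\boldsymbol\alpha}\bar u^{\boldsymbol\beta}\big|_{r,p'}<\infty$. *Projections.* Write $u=(v,z)$, $v=(u_j)_{j\in\mathcal S}$, $z=(u_j)_{j\in\mathcal S^c}$, and $H=\sum H_{m,\alpha,\beta,a,b}|v|^{2m}v^\alpha\bar v^\beta z^a\bar z^b$ with $\alpha,\beta$ of disjoint supports. Put $$\Pi^dH=\sum_{\delta'\le m,\ 2|\delta'|+|a|+|b|=d+2}H_{m,\alpha,\beta,a,b}\binom m{\delta'}I^{m-\delta'}(|v|^2-I)^{\delta'}v^\alpha\bar v^\beta z^a\bar z^b,\qquad\Pi^{\le0}=\Pi^{-2}+\Pi^{-1}+\Pi^0,$$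 and $\Pi^{\mathcal R}H=H-\sum_{\boldsymbol\alpha}H_{\boldsymbol\alpha,\boldsymbol\alpha}|u|^{2\boldsymbol\alpha}$. Let $\mathcal H^{\le0,\mathcal R}_{r,p'}$ be the set of $H\in\mathcal H_{r,p'}$ with $\Pi^{\le0}H=H=\Pi^{\mathcal R}H$. **Proposition.** There is a constant $c>0$, depending only on $i_*$ (and, if $\mathcal S_0\neq\emptyset$, on upper bounds for the number of elements of $\mathcal S_0$ and for their indices), such that for all $\eta$, $\mathcal S$ as above and all $\gamma>0$, $r>0$, $p>1$, $0<\delta<1$, both in the real and in the complex case, the following holds. Let $L_\omega H=\{D(\omega),H\}=\mathrm i\sum\omega\cdot(\boldsymbol\alpha-\boldsymbol\beta)H_{\boldsymbol\alpha,\boldsymbol\beta}u^{\boldsymbol\alpha}\bar u^{\boldsymbol\beta}$, where $D(\omega)=\sum_j\omega_j|u_j|^2$. The formula $$(L_\omega^{-1}H)_{\boldsymbol\alpha,\boldsymbol\beta}=\frac{-\mathrm i\,H_{\boldsymbol\alpha,\boldsymbol\beta}}{\omega\cdot(\boldsymbol\alpha-\boldsymbol\beta)}\qquad(\boldsymbol\alpha\neq\boldsymbol\beta;\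 \text{the coefficient is }0\text{ where }H_{\boldsymbol\alpha,\boldsymbol\beta}=0)$$ defines a bounded linear operator $L^{-1}:\mathcal H^{\le0,\mathcal R}_{r,p}\to\mathcal H^{\le0,\mathcal R}_{r,p+\delta}$, which is a two-sided inverse of $L$ at the level of coefficients ($L L^{-1}H=H=L^{-1}LH$ for $H\in\mathcal H^{\le0,\mathcal R}_{r,p}$), and $$\|L^{-1}H\|_{r,p+\delta}\le\frac1\gamma\exp\Big(\exp\Big(\frac c{\delta^{1/\eta}}\Big)\Big)\|H\|_{r,p}.$$ -/

import Mathlib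

open scoped ENNReal

noncomputable section

/-! ### Weighted sequence spaces -/

/-- The weight `max {2, |j|}`. -/
def jj (j : ℤ) : ℝ := max 2 |(j : ℝ)|

theorem jj_pos (j : ℤ) : 0 < jj j := lt_of_lt_of_le two_pos (le_max_left _ _)

/-- Sequences `u` indexed by `ℤ` for which `sup_j |u_j| (max {2, |j|}) ^ q` is finite. -/
def weightedSubmodule (𝕜 : Type) [NontriviallyNormedField 𝕜] (q : ℝ) : Submodule 𝕜 (ℤ → 𝕜) where
  carrier := {u | BddAbove (Set.range fun j : ℤ => ‖u j‖ * jj j ^ q)}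
  zero_mem' := ⟨0, by rintro _ ⟨j, rfl⟩; simp⟩
  add_mem' := by
    rintro u v ⟨a, ha⟩ ⟨b, hb⟩
    refine ⟨a + b, ?_⟩
    rintro _ ⟨j, rfl⟩
    have h1 := ha ⟨j, rfl⟩
    have h2 := hb ⟨j, rfl⟩
    have h3 := mul_le_mul_of_nonneg_right (norm_add_le (u j) (v j))
      (Real.rpow_nonneg (jj_pos j).le q)
    simp only [Pi.add_apply] at *
    linarith
  smul_mem' := by
    rintro t u ⟨a, ha⟩
    refine ⟨‖t‖ * a, ?_⟩
    rintro _ ⟨j, rfl⟩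
    have h1 := mul_le_mul_of_nonneg_left (ha ⟨j, rfl⟩) (norm_nonneg t)
    simpa [norm_smul, mul_assoc] using h1

/-- The Banach space `w_q` (over `ℝ` or `ℂ`) with norm `|u|_q = sup_j |u_j| (max {2, |j|}) ^ q`.
For `q > 1`, which is the only case of interest, its elements are automatically in `ℓ¹`. -/
def WSpace (𝕜 : Type) [NontriviallyNormedField 𝕜] (q : ℝ) : Type := weightedSubmodule 𝕜 q

namespace WSpace

variable {𝕜 : Type} [NontriviallyNormedField 𝕜] {q : ℝ}

instance : AddCommGroup (WSpace 𝕜 q) := inferInstanceAs (AddCommGroup (weightedSubmodule 𝕜 q))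

instance : Module 𝕜 (WSpace 𝕜 q) := inferInstanceAs (Module 𝕜 (weightedSubmodule 𝕜 q))

/-- The `j`-th entry of a sequence. -/
def entry (u : WSpace 𝕜 q) (j : ℤ) : 𝕜 := u.1 j

theorem bdd (u : WSpace 𝕜 q) : BddAbove (Set.range fun j : ℤ => ‖u.entry j‖ * jj j ^ q) := u.2

/-- The weighted sup norm. -/
def supNorm (u : WSpace 𝕜 q) : ℝ := ⨆ j : ℤ, ‖u.entry j‖ * jj j ^ q

theorem le_supNorm (u : WSpace 𝕜 q) (j : ℤ) : ‖u.entry j‖ * jj j ^ q ≤ u.supNorm :=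
  le_ciSup u.bdd j

/-- The weighted sup norm, as a norm on an additive group. -/
def groupNorm : AddGroupNorm (WSpace 𝕜 q) where
  toFun := supNorm
  map_zero' := by
    have h : ∀ j, (0 : WSpace 𝕜 q).entry j = 0 := fun _ => rfl
    simp [supNorm, h]
  add_le' u v := by
    refine ciSup_le fun j => ?_
    have h3 := mul_le_mul_of_nonneg_right (norm_add_le (u.entry j) (v.entry j))
      (Real.rpow_nonneg (jj_pos j).le q)
    have h1 := u.le_supNorm j
    have h2 := v.le_supNorm j
    have h : (u + v).entry j = u.entry j + v.entry j := rfl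
    rw [h]
    linarith
  neg' u := by
    have h : ∀ j, (-u).entry j = -u.entry j := fun _ => rfl
    simp [supNorm, h]
  eq_zero_of_map_eq_zero' u hu := by
    refine Subtype.ext (funext fun j => ?_)
    have h1 := u.le_supNorm j
    rw [show u.supNorm = 0 from hu] at h1
    have h2 := Real.rpow_pos_of_pos (jj_pos j) q
    exact norm_le_zero_iff.mp (nonpos_of_mul_nonpos_left h1 h2)

instance : NormedAddCommGroup (WSpace 𝕜 q) := groupNorm.toNormedAddCommGroup

instance : NormedSpace 𝕜 (WSpace 𝕜 q) where
  norm_smul_le t u := by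
    refine ciSup_le fun j => ?_
    have h : (t • u).entry j = t * u.entry j := rfl
    rw [h, norm_mul, mul_assoc]
    exact mul_le_mul_of_nonneg_left (u.le_supNorm j) (norm_nonneg t)

end WSpace

/-! ### Tangential sites, frequencies and actions -/

/-- The conditions on the function `s : [0, ∞) → [0, ∞)` that enumerates an admissible set `s(ℕ)` of
sites in `ℕ`, with parameters `i_*` and `η`. -/
structure IsAdmissibleSeq (istar η : ℝ) (s : ℝ → ℝ) : Prop where
  smooth : ContDiffOn ℝ ((⊤ : ℕ∞) : WithTop ℕ∞) s (Set.Ici 0)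
  strictMono : StrictMonoOn s (Set.Ici 0)
  nonneg : ∀ x, 0 ≤ x → 0 ≤ s x
  nat_values : ∀ n : ℕ, ∃ m : ℕ, s n = m
  istar_ge : 21 ≤ istar
  one_lt_eta : 1 < η
  eta_le_two : η ≤ 2
  growth : ∀ i, istar ≤ i → Real.exp (Real.log i ^ (1 + η)) ≤ s i
  superadditive : ∀ i i', istar ≤ i → istar ≤ i' → s i + s i' ≤ s (i + i')
  superhomogeneous : ∀ h i, 1 ≤ h → istar ≤ i → h * s i ≤ s (h * i)
  square : ∀ i, istar ≤ i → s i ^ 2 ≤ s (i ^ 2)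

/-- Admissible tangential sites in `ℤ`: `S` is one of `S₂ ∪ S₀`, `(-S₁) ∪ S₀`, `(-S₁) ∪ S₂ ∪ S₀` with
`S₀` finite (possibly empty) and `S₁ = s₁(ℕ)`, `S₂ = s₂(ℕ)` admissible sets of sites in `ℕ`.
`B` is the set of signs that occur, `s (-1) = s₁` and `s 1 = s₂`.
The function `idx` plays the role of the inverse function `i(s)`: it maps `± s(n)` to `n`, except that
its values at the points of the finite set `S₀` are unconstrained. -/
def IsAdmissible (istar η : ℝ) (S₀ : Finset ℤ) (idx : ℤ → ℕ) (S : Set ℤ) : Prop :=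
  ∃ (B : Set ℤ) (s : ℤ → ℝ → ℝ), B.Nonempty ∧ B ⊆ {1, -1} ∧
    (∀ σ ∈ B, IsAdmissibleSeq istar η (s σ)) ∧
    S = (S₀ : Set ℤ) ∪ {j | ∃ σ ∈ B, ∃ n : ℕ, (j : ℝ) = σ * s σ n} ∧
    ∀ σ ∈ B, ∀ (n : ℕ) (j : ℤ), (j : ℝ) = σ * s σ n → j ∉ S₀ → idx j = n

/-- The cube `Q` of frequencies. -/
def freqCube : Set (ℤ → ℝ) := {ω | ∀ j : ℤ, |ω j - (j : ℝ) ^ 2| < 1 / 2}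

/-- `ω · ℓ`. -/
def freqDot (ω : ℤ → ℝ) (l : ℤ →₀ ℤ) : ℝ := l.sum fun j n => ω j * (n : ℝ)

open Classical in
/-- The product over `s ∈ S` of `(1 + |ℓ_s|² ⟨i(s)⟩²) ^ (-3/2)`, where `⟨i⟩ = max {1, i}`.
Factors with `ℓ_s = 0` are equal to `1`. -/
def diophWeight (S : Set ℤ) (idx : ℤ → ℕ) (l : ℤ →₀ ℤ) : ℝ :=
  l.prod fun s n => if s ∈ S then
    1 / (1 + |(n : ℝ)| ^ 2 * (max 1 (idx s : ℝ)) ^ 2) ^ (3 / 2 : ℝ) else 1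

open Classical in
/-- The set of Diophantine frequencies. -/
def dioph (γ : ℝ) (S : Set ℤ) (idx : ℤ → ℕ) : Set (ℤ → ℝ) :=
  {ω | ω ∈ freqCube ∧ ∀ l : ℤ →₀ ℤ, l ≠ 0 →
    (l.sum fun j n => if j ∈ S then 0 else |n|) ≤ 2 →
    (l.sum fun j n => j * n) = 0 → (l.sum fun _ n => n) = 0 →
    γ * diophWeight S idx l ≤ |freqDot ω l|}

/-- Real tangential actions: the nonnegative sequences in the open ball of radius `r²` of `w_{2p}`
that vanish outside `S`. -/
def actionsReal (S : Set ℤ) (p r : ℝ) : Set (WSpace ℝ (2 * p)) :=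
  {I | ‖I‖ < r ^ 2 ∧ (∀ j, j ∉ S → I.entry j = 0) ∧ ∀ j, 0 ≤ I.entry j}

/-- Complex tangential actions: the open ball of radius `r²` in the space of the sequences in `w_{2p}`
that vanish outside `S`. -/
def actionsComplex (S : Set ℤ) (p r : ℝ) : Set (WSpace ℂ (2 * p)) :=
  {I | ‖I‖ < r ^ 2 ∧ ∀ j, j ∉ S → I.entry j = 0}

/-- The complex actions which are real tangential actions. -/
def realPoints (S : Set ℤ) (p r : ℝ) : Set (actionsComplex S p r) :=
  {I | ∀ j, (I.1.entry j).im = 0 ∧ 0 ≤ (I.1.entry j).re}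

/-! ### Regular Hamiltonians -/

/-- Finitely supported multi-indices in `ℕ^ℤ`. -/
abbrev MIdx : Type := ℤ →₀ ℕ

/-- `α - β` as an integer vector. -/
def midxDiff (α β : MIdx) : ℤ →₀ ℤ :=
  α.mapRange (fun n : ℕ => (n : ℤ)) rfl - β.mapRange (fun n : ℕ => (n : ℤ)) rfl

/-- `|α| = ∑_j α_j`. -/
def midxSize (α : MIdx) : ℕ := α.sum fun _ n => n

/-- `u^α = ∏_j u_j^{α_j}`. -/
def midxPow (u : ℤ → ℂ) (α : MIdx) : ℂ := α.prod fun j n => u j ^ n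

/-- `binom(α, β) = ∏_j binom(α_j, β_j)`, used for `β ≤ α`. -/
def midxChoose (α β : MIdx) : ℕ := α.prod fun j n => n.choose (β j)

/-- The pairs of multi-indices that conserve mass and momentum. -/
def conserves (α β : MIdx) : Prop :=
  midxSize α = midxSize β ∧ ((midxDiff α β).sum fun j n => j * n) = 0

/-- A formal power series `∑ h_{αβ} u^α ū^β`, given by its coefficients. -/
abbrev FormalHam : Type := MIdx → MIdx → ℂ

/-- The monomial with index `(α, β)` in `∂_{ū_j}` of the majorant `∑ |h_{αβ}| u^α ū^β`. -/
def majorantTerm (h : FormalHam) (u : ℤ → ℂ) (j : ℤ) (q : MIdx × MIdx) : ℂ :=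
  (‖h q.1 q.2‖ : ℂ) * (q.2 j : ℂ) * midxPow u q.1 *
    midxPow (fun i => starRingEnd ℂ (u i)) (q.2 - Finsupp.single j 1)

open Classical in
/-- `|X_j(u)|`, where `X_j = i ∂_{ū_j}` is the `j`-th component of the Hamiltonian vector field
of the majorant; it is `∞` where the series does not converge absolutely. -/
def fieldSize (h : FormalHam) (u : ℤ → ℂ) (j : ℤ) : ℝ≥0∞ :=
  if Summable (majorantTerm h u j) then ‖Complex.I * ∑' q, majorantTerm h u j q‖ₑ else ∞

/-- `|h|_{r,p}`: `1/r` times the supremum of `|X(u)|_p` over the closed ball `|u|_p ≤ r`, where `X` is the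
Hamiltonian vector field of the majorant of `h`. -/
def hamNorm (r p : ℝ) (h : FormalHam) : ℝ≥0∞ :=
  (ENNReal.ofReal r)⁻¹ * ⨆ (u : WSpace ℂ p) (_ : ‖u‖ ≤ r) (j : ℤ),
    fieldSize h u.entry j * ENNReal.ofReal (jj j ^ p)

/-- Regular Hamiltonians, without the reality condition. -/
structure IsRegularHam (r p : ℝ) (h : FormalHam) : Prop where
  support : ∀ α β, ¬ conserves α β → h α β = 0
  finite : hamNorm r p h < ∞

/-- The reality condition. -/
def IsReal (h : FormalHam) : Prop := ∀ α β, h α β = starRingEnd ℂ (h β α)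

/-! ### Dependence on parameters -/

section Parameters

variable {𝕜 : Type} [NontriviallyNormedField 𝕜] [NormedAlgebra 𝕜 ℂ]
  {E : Type} [NormedAddCommGroup E] [NormedSpace 𝕜 E] {O : Set (ℤ → ℝ)} {A : Set E}

/-- `|ω - ω'|_∞`. -/
def freqDist (ω ω' : ℤ → ℝ) : ℝ≥0∞ := ⨆ j, ‖ω j - ω' j‖ₑ

/-- The weighted Lipschitz norm `|f|^γ` of a function of frequency and action. -/
def lipNorm (γ : ℝ) (f : O → A → ℂ) : ℝ≥0∞ :=
  (⨆ (ω : O) (I : A), ‖f ω I‖ₑ) +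
    ENNReal.ofReal γ * ⨆ (ω : O) (ω' : O) (_ : ω ≠ ω') (I : A),
      ‖f ω I - f ω' I‖ₑ / freqDist ω.1 ω'.1

variable (𝕜) in
/-- Functions of finite norm which are continuous in the frequency (for the product topology) and
analytic in the action. -/
structure IsCLip (γ : ℝ) (f : O → A → ℂ) : Prop where
  finite : lipNorm γ f < ∞
  continuous : ∀ I, Continuous fun ω => f ω I
  analytic : ∀ ω, ∃ F : E → ℂ, AnalyticOn 𝕜 F A ∧ ∀ I : A, f ω I = F I

variable (𝕜) in
/-- Functions as above which depend on finitely many frequencies only. -/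
def IsFinDep (γ : ℝ) (f : O → A → ℂ) : Prop :=
  IsCLip 𝕜 γ f ∧ ∃ k : ℕ, ∀ ω ω' : O, (∀ j : ℤ, |j| ≤ k → ω.1 j = ω'.1 j) → f ω = f ω'

variable (𝕜) in
/-- The closure, in the norm `|·|^γ`, of the functions which depend on finitely many frequencies. -/
def IsLimFinDep (γ : ℝ) (f : O → A → ℂ) : Prop :=
  IsCLip 𝕜 γ f ∧ ∀ ε : ℝ, 0 < ε → ∃ g : O → A → ℂ, IsFinDep 𝕜 γ g ∧
    lipNorm γ (f - g) ≤ ENNReal.ofReal ε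

/-- Families of formal Hamiltonians depending on a frequency in `O` and an action in `A`. -/
abbrev HamFamily (O : Set (ℤ → ℝ)) {E : Type} (A : Set E) : Type := MIdx → MIdx → O → A → ℂ

/-- The norm `‖H‖_{r,p}`, i.e. the norm of the formal Hamiltonian with coefficients `|H_{αβ}|^γ`. -/
def famNorm (γ r p : ℝ) (H : HamFamily O A) : ℝ≥0∞ :=
  hamNorm r p fun α β => ((lipNorm γ (H α β)).toReal : ℂ)

variable (𝕜) in
/-- The space of parameter depending Hamiltonians; the reality condition is imposed at the
actions in `R`. -/
structure IsHamFamily (γ r p : ℝ) (R : Set A) (H : HamFamily O A) : Prop where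
  regular : ∀ ω I, IsRegularHam r p fun α β => H α β ω I
  real : ∀ ω, ∀ I ∈ R, IsReal fun α β => H α β ω I
  coeff : ∀ α β, IsLimFinDep 𝕜 γ (H α β)
  finite : famNorm γ r p H < ∞

/-! ### Projections -/

open Classical in
/-- The tangential part `k` of a monomial: `u^α ū^β = |v|^{2k} v^{α'} v̄^{β'} z^a z̄^b`, with `α'`, `β'`
of disjoint supports in `S` and with `a`, `b` supported outside `S`. -/
def tangPart (S : Set ℤ) (α β : MIdx) : MIdx := (α ⊓ β).filter (· ∈ S)

open Classical in
/-- The degree `|a| + |b|` of a monomial in the normal variables. -/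
def normalDeg (S : Set ℤ) (α β : MIdx) : ℕ := midxSize ((α + β).filter (· ∉ S))

open Classical in
/-- The projection `Π^d` at the actions `I`. Writing
`h = ∑ h_{m,α',β',a,b} |v|^{2m} v^{α'} v̄^{β'} z^a z̄^b`, the projection is the sum of
`h_{m,α',β',a,b} binom(m,δ) I^{m-δ} (|v|² - I)^δ v^{α'} v̄^{β'} z^a z̄^b` over all indices with `δ ≤ m` and
`2|δ| + |a| + |b| = d + 2`. After the expansion
`(|v|² - I)^δ = ∑_{k ≤ δ} binom(δ,k) (-I)^{δ-k} |v|^{2k}` its coefficient at `u^α ū^β` is the sum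
below, over the pairs `(m, δ)`, with `k` the tangential part of `(α, β)`. -/
def projDeg (S : Set ℤ) (I : ℤ → ℂ) (d : ℤ) (h : FormalHam) : FormalHam := fun α β =>
  ∑' q : MIdx × MIdx,
    if (∀ j, j ∉ S → q.1 j = 0) ∧ tangPart S α β ≤ q.2 ∧ q.2 ≤ q.1 ∧
        2 * (midxSize q.2 : ℤ) + normalDeg S α β = d + 2 then
      h (α + (q.1 - tangPart S α β)) (β + (q.1 - tangPart S α β)) *
        (midxChoose q.1 q.2 : ℂ) * midxPow I (q.1 - q.2) *
        ((midxChoose q.2 (tangPart S α β) : ℂ) * midxPow (fun j => -I j) (q.2 - tangPart S α β))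
    else 0

/-- `Π^{≤ 0} = Π^{-2} + Π^{-1} + Π^{0}`. -/
def projLeZero (S : Set ℤ) (I : ℤ → ℂ) (h : FormalHam) : FormalHam :=
  projDeg S I (-2) h + projDeg S I (-1) h + projDeg S I 0 h

open Classical in
/-- The projection `Π^K` on the monomials `|u|^{2α}`. -/
def projK (h : FormalHam) : FormalHam := fun α β => if α = β then h α β else 0

/-- The projection `Π^R = Id - Π^K`. -/
def projR (h : FormalHam) : FormalHam := h - projK h

/-- The space of the families `H` of Hamiltonians with `Π^{≤0} H = H` and `Π^R H = H`. -/
def HamLeZeroR {𝕜 : Type} [NontriviallyNormedField 𝕜] [NormedAlgebra 𝕜 ℂ] {O : Set (ℤ → ℝ)} {q : ℝ}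
    {A : Set (WSpace 𝕜 q)} (S : Set ℤ) (R : Set A) (γ r p : ℝ) : Set (HamFamily O A) :=
  {H | IsHamFamily 𝕜 γ r p R H ∧
    (∀ ω I, projLeZero S (fun j => algebraMap 𝕜 ℂ (I.1.entry j)) (fun α β => H α β ω I) =
      fun α β => H α β ω I) ∧
    ∀ ω I, projR (fun α β => H α β ω I) = fun α β => H α β ω I}

/-! ### The homological operator -/

/-- The operator `L_ω = {D(ω), ·}` on formal Hamiltonians. -/
def lieD (O : Set (ℤ → ℝ)) {E : Type} (A : Set E) : HamFamily O A →ₗ[ℂ] HamFamily O A where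
  toFun H := fun α β ω I => Complex.I * (freqDot ω.1 (midxDiff α β) : ℂ) * H α β ω I
  map_add' H K := by funext α β ω I; simp only [Pi.add_apply]; ring
  map_smul' t H := by
    funext α β ω I; simp only [Pi.smul_apply, smul_eq_mul, RingHom.id_apply]; ring

/-- The operator `L_ω⁻¹`, with coefficients `-i H_{αβ} / (ω · (α - β))`. -/
def lieInv (O : Set (ℤ → ℝ)) {E : Type} (A : Set E) : HamFamily O A →ₗ[ℂ] HamFamily O A where
  toFun H := fun α β ω I => -Complex.I * H α β ω I / (freqDot ω.1 (midxDiff α β) : ℂ)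
  map_add' H K := by funext α β ω I; simp only [Pi.add_apply]; ring
  map_smul' t H := by
    funext α β ω I; simp only [Pi.smul_apply, smul_eq_mul, RingHom.id_apply]; ring

end Parameters

end

/-! ### Weights of multi-indices -/

/-! On coefficients, `L⁻¹` is multiplication by `-i / (ω · ℓ)` with `ℓ = α - β`. Replacing `p` by `p
+ δ` leaves room for a multiplier of size `K exp (δ (W - 2 log ⌊j⌋))` in the `j`-th component of the
vector field, where `W` is the sum of the `log ⌊s⌋` over the sites of `α + β`
(`hamNorm_le_of_norm_le`). Conservation of momentum bounds the largest site by the second largest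
one times one plus the number of the others, so `W - 2 log ⌊j⌋` is at least half of the weight of
the sites other than the two largest, up to a constant (`LargestPair.half_le_gain`). It remains to
bound the weighted Lipschitz norm of the multiplier, at most `1/m + γ |ℓ|₁ / m²` if `|ω · ℓ| ≥ m`,
by such an exponential (`IsAdmissible.exists_divisor_bound`).

Since `|ω_j - j²| < 1/2`, the divisor differs from `∑ j² ℓ_j` by at most `|ℓ|₁ / 2`. If `|∑ j² ℓ_j|
≥ |ℓ|₁`, the divisor is not small, and all that is needed is a bound for `γ`: testing the
Diophantine condition on an explicit resonant vector shows that `γ` cannot be large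
(`IsAdmissible.le_gammaBound`).

If `|∑ j² ℓ_j| < |ℓ|₁`, momentum and quadratic energy together force the two largest sites either to
cancel in `ℓ` or to be polynomially bounded by the others (`LargestPair.cancel_or_log_le`). The
Diophantine condition then costs a multiple of `∑ log (1 + |ℓ_s| ⟨i(s)⟩)`. Because `log s ≥ (log
i)^{1+η}`, every site of index beyond about `N = exp ((1152/δ)^{1/η})` pays for itself with a small
part of the gain; the remaining `O(N)` sites cost `O(N/δ)` each (`IsAdmissible.siteLogSum_le`). The
total loss in the exponent is at most `exp (c / δ^{1/η})`, hence the double exponential.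

The Diophantine condition is applicable because `Π^{≤0} H = H` leaves only monomials of normal
degree at most two, and `L⁻¹` preserves the space because its multiplier depends on `α - β` only. -/

theorem two_le_jj (j : ℤ) : 2 ≤ jj j := le_max_left _ _

theorem abs_le_jj (j : ℤ) : |(j : ℝ)| ≤ jj j := le_max_right _ _

theorem jj_mono {i j : ℤ} (h : |i| ≤ |j|) : jj i ≤ jj j :=
  max_le_max le_rfl (by exact_mod_cast h)

theorem half_le_log_jj (j : ℤ) : 1 / 2 ≤ Real.log (jj j) := by
  have h := Real.log_le_log two_pos (two_le_jj j)
  have := Real.log_two_gt_d9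
  linarith

/-- The logarithm of `∏_j (max {2, |j|}) ^ α_j`. -/
noncomputable def logWeight (α : MIdx) : ℝ := α.sum fun s n => (n : ℝ) * Real.log (jj s)

theorem logWeight_add (α β : MIdx) : logWeight (α + β) = logWeight α + logWeight β :=
  Finsupp.sum_add_index' (by simp) (by intros; push_cast; ring)

theorem logWeight_single (j : ℤ) : logWeight (Finsupp.single j 1) = Real.log (jj j) := by
  simp [logWeight]

theorem logWeight_nonneg (α : MIdx) : 0 ≤ logWeight α :=
  Finset.sum_nonneg fun s _ => mul_nonneg (Nat.cast_nonneg _)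
    (by linarith [half_le_log_jj s])

/-- One plus a sum is at most the product of the `(1 + f s) ^ n`, by Bernoulli at each site. This
trades quantities polynomial in the sites for exponentials of `logWeight`. -/
theorem one_add_sum_le_exp_logWeight {f : ℤ → ℝ} {k : ℝ} (hf : ∀ s, 0 ≤ f s)
    (h : ∀ s, 1 + f s ≤ Real.exp (k * Real.log (jj s))) (R : MIdx) :
    1 + (R.sum fun s n => (n : ℝ) * f s) ≤ Real.exp (k * logWeight R) := by
  induction R using Finsupp.induction_linear with
  | zero => simp [logWeight]
  | add R T hR hT =>
    have hs (X : MIdx) : 0 ≤ X.sum fun s n => (n : ℝ) * f s :=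
      Finset.sum_nonneg fun s _ => mul_nonneg (Nat.cast_nonneg _) (hf s)
    rw [Finsupp.sum_add_index' (by simp) (by intros; push_cast; ring), logWeight_add, mul_add,
      Real.exp_add]
    have := mul_le_mul hR hT (by linarith [hs T]) (Real.exp_nonneg _)
    nlinarith [mul_nonneg (hs R) (hs T)]
  | single s n =>
    simp only [logWeight, Finsupp.sum_single_index, Nat.cast_zero, zero_mul]
    rw [mul_left_comm, Real.exp_nat_mul]
    exact (one_add_mul_le_pow (by linarith [hf s]) n).trans
      (pow_le_pow_left₀ (by linarith [hf s]) (h s) n)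

theorem midxSize_add (α β : MIdx) : midxSize (α + β) = midxSize α + midxSize β :=
  Finsupp.sum_add_index' (by simp) (by simp)

theorem cast_midxSize (α : MIdx) : (midxSize α : ℝ) = α.sum fun _ n => (n : ℝ) := by
  simp [midxSize, Finsupp.sum]

theorem one_add_mul_midxSize_le {x k : ℝ} (hx : 0 ≤ x)
    (h : ∀ s, 1 + x ≤ Real.exp (k * Real.log (jj s))) (R : MIdx) :
    1 + midxSize R * x ≤ Real.exp (k * logWeight R) := by
  have := one_add_sum_le_exp_logWeight (f := fun _ => x) (fun _ => hx) h R
  rwa [cast_midxSize, Finsupp.sum_mul]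

theorem one_add_midxSize_le (R : MIdx) : 1 + (midxSize R : ℝ) ≤ Real.exp (logWeight R) := by
  have := one_add_mul_midxSize_le (x := 1) (k := 1) zero_le_one
    (fun s => by rw [one_mul, Real.exp_log (jj_pos s)]; linarith [two_le_jj s]) R
  simpa using this

theorem one_add_midxSize_le_half (R : MIdx) :
    1 + (midxSize R : ℝ) ≤ 3 * Real.exp (logWeight R / 2) := by
  -- `2/5` is admissible since `(7/5)² ≤ 2 ≤ ⌊s⌋`; the prefactor 3 exceeds `1 / (2/5)`.
  have := one_add_mul_midxSize_le (x := 2 / 5) (k := 1 / 2) (by norm_num)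
    (fun s => by
      have h : (7 / 5 : ℝ) ^ 2 ≤ Real.exp (1 / 2 * Real.log (jj s)) ^ 2 := by
        rw [← Real.exp_nat_mul, ← mul_assoc]
        norm_num
        rw [Real.exp_log (jj_pos s)]
        linarith [two_le_jj s]
      have := le_of_sq_le_sq h (Real.exp_nonneg _)
      linarith) R
  rw [show logWeight R / 2 = 1 / 2 * logWeight R by ring]
  have h0 : (0 : ℝ) ≤ midxSize R := Nat.cast_nonneg _
  linarith

/-- Makes the factor `1 + |ℓ|₁` from the Lipschitz seminorm affordable: it costs a small part of the
gain and a factor `16/δ`. -/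
theorem three_add_midxSize_le {δ : ℝ} (hδ : 0 < δ) (hδ1 : δ < 1) (R : MIdx) :
    3 + (midxSize R : ℝ) ≤ 16 / δ * Real.exp (δ / 8 * logWeight R) := by
  have := one_add_mul_midxSize_le (x := δ / 16) (k := δ / 8) (by positivity)
    (fun s => by
      have := Real.add_one_le_exp (δ / 8 * Real.log (jj s))
      nlinarith [half_le_log_jj s]) R
  have h2 := mul_le_mul_of_nonneg_left this (show 0 ≤ 16 / δ by positivity)
  have h3 : 16 / δ * (1 + midxSize R * (δ / 16)) = 16 / δ + midxSize R := by
    field_simp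
  have h4 : 3 ≤ 16 / δ := by rw [le_div_iff₀ hδ]; linarith
  linarith

/-! ### Integer vectors -/

/-- `∑_j |ℓ_j|`. -/
noncomputable def lOne (l : ℤ →₀ ℤ) : ℝ := l.sum fun _ n => |(n : ℝ)|

/-- `∑_j j ℓ_j`. -/
def momentum (l : ℤ →₀ ℤ) : ℤ := l.sum fun j n => j * n

/-- `∑_j j² ℓ_j`. -/
def energy (l : ℤ →₀ ℤ) : ℤ := l.sum fun j n => j ^ 2 * n

theorem momentum_add (l k : ℤ →₀ ℤ) : momentum (l + k) = momentum l + momentum k :=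
  Finsupp.sum_add_index' (by simp) (by intros; ring)

theorem energy_add (l k : ℤ →₀ ℤ) : energy (l + k) = energy l + energy k :=
  Finsupp.sum_add_index' (by simp) (by intros; ring)

theorem momentum_single (a n : ℤ) : momentum (Finsupp.single a n) = a * n := by simp [momentum]

theorem energy_single (a n : ℤ) : energy (Finsupp.single a n) = a ^ 2 * n := by simp [energy]

theorem midxDiff_apply (α β : MIdx) (s : ℤ) : midxDiff α β s = (α s : ℤ) - β s := by
  simp [midxDiff]

theorem abs_midxDiff_apply_le (α β : MIdx) (s : ℤ) : |midxDiff α β s| ≤ ((α + β) s : ℕ) := by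
  rw [midxDiff_apply, abs_le, Finsupp.add_apply]
  omega

theorem sum_le_sum_of_abs_le {M : Type*} [Zero M] {l : ℤ →₀ M} {R : MIdx} {φ : ℤ → M → ℝ}
    {ψ : ℤ → ℕ → ℝ} (hsupp : ∀ s, R s = 0 → l s = 0) (hψ : ∀ s n, 0 ≤ ψ s n)
    (h : ∀ s, l s ≠ 0 → φ s (l s) ≤ ψ s (R s)) : l.sum φ ≤ R.sum ψ :=
  (Finset.sum_le_sum fun s hs => h s (Finsupp.mem_support_iff.mp hs)).trans
    (Finset.sum_le_sum_of_subset_of_nonneg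
      (fun s hs => by
        rw [Finsupp.mem_support_iff] at hs ⊢
        exact fun h0 => hs (hsupp s h0)) fun s _ _ => hψ s _)

theorem midxDiff_apply_eq_zero {α β : MIdx} {s : ℤ} (h : (α + β) s = 0) : midxDiff α β s = 0 := by
  rw [midxDiff_apply]
  rw [Finsupp.add_apply] at h
  omega

theorem midxDiff_sum_le {α β : MIdx} {φ : ℤ → ℤ → ℝ} {ψ : ℤ → ℕ → ℝ} (hψ : ∀ s n, 0 ≤ ψ s n)
    (h : ∀ (s n : ℤ) (m : ℕ), |n| ≤ m → φ s n ≤ ψ s m) :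
    (midxDiff α β).sum φ ≤ (α + β).sum ψ :=
  sum_le_sum_of_abs_le (fun _ => midxDiff_apply_eq_zero) hψ
    fun s _ => h s _ _ (abs_midxDiff_apply_le α β s)

theorem abs_cast_le_cast {n : ℤ} {m : ℕ} (h : |n| ≤ m) : |(n : ℝ)| ≤ m := by exact_mod_cast h

theorem sum_add_le_of_subadditive {R : Type*} [AddCommMonoid R] [PartialOrder R]
    [IsOrderedAddMonoid R] {φ : ℤ → ℤ → R} (h0 : ∀ s, φ s 0 = 0)
    (hφ : ∀ s x y, φ s (x + y) ≤ φ s x + φ s y) (l k : ℤ →₀ ℤ) :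
    (l + k).sum φ ≤ l.sum φ + k.sum φ := by
  classical
  rw [Finsupp.sum_of_support_subset (l + k) Finsupp.support_add φ fun s _ => h0 s,
    Finsupp.sum_of_support_subset l (Finset.subset_union_left (s₂ := k.support)) φ fun s _ => h0 s,
    Finsupp.sum_of_support_subset k (Finset.subset_union_right (s₁ := l.support)) φ
      fun s _ => h0 s, ← Finset.sum_add_distrib]
  exact Finset.sum_le_sum fun s _ => hφ s _ _

theorem lOne_midxDiff_le (α β : MIdx) : lOne (midxDiff α β) ≤ midxSize (α + β) := by
  rw [cast_midxSize]
  exact midxDiff_sum_le (fun _ _ => Nat.cast_nonneg _) fun s n m h => abs_cast_le_cast h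

theorem abs_momentum_le (α β : MIdx) :
    |(momentum (midxDiff α β) : ℝ)| ≤ (α + β).sum fun s n => (n : ℝ) * |(s : ℝ)| := by
  have : |(momentum (midxDiff α β) : ℝ)| ≤
      (midxDiff α β).sum fun s n => |(n : ℝ)| * |(s : ℝ)| := by
    simp only [momentum, Finsupp.sum]
    push_cast
    refine (Finset.abs_sum_le_sum_abs _ _).trans (Finset.sum_le_sum fun s _ => ?_)
    rw [abs_mul, mul_comm]
  refine this.trans (midxDiff_sum_le (fun _ _ => by positivity) fun s n m h => ?_)
  exact mul_le_mul_of_nonneg_right (abs_cast_le_cast h) (abs_nonneg _)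

theorem abs_energy_le (α β : MIdx) :
    |(energy (midxDiff α β) : ℝ)| ≤ (α + β).sum fun s n => (n : ℝ) * jj s ^ 2 := by
  have : |(energy (midxDiff α β) : ℝ)| ≤
      (midxDiff α β).sum fun s n => |(n : ℝ)| * |(s : ℝ)| ^ 2 := by
    simp only [energy, Finsupp.sum]
    push_cast
    refine (Finset.abs_sum_le_sum_abs _ _).trans (Finset.sum_le_sum fun s _ => ?_)
    rw [abs_mul, mul_comm, abs_pow]
  refine this.trans (midxDiff_sum_le (fun _ _ => by positivity) fun s n m h => ?_)
  exact mul_le_mul (abs_cast_le_cast h)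
    (pow_le_pow_left₀ (abs_nonneg _) (abs_le_jj s) 2) (by positivity) (Nat.cast_nonneg _)

theorem midxDiff_add_single_left (α β : MIdx) (a : ℤ) :
    midxDiff (Finsupp.single a 1 + α) β = Finsupp.single a 1 + midxDiff α β := by
  ext s
  simp only [midxDiff_apply, Finsupp.add_apply, Finsupp.single_apply]
  split_ifs <;> push_cast <;> ring

theorem midxDiff_add_single_right (α β : MIdx) (a : ℤ) :
    midxDiff α (Finsupp.single a 1 + β) = Finsupp.single a (-1) + midxDiff α β := by
  ext s
  simp only [midxDiff_apply, Finsupp.add_apply, Finsupp.single_apply]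
  split_ifs <;> push_cast <;> ring

theorem single_add_tsub {α : MIdx} {a : ℤ} (h : α a ≠ 0) :
    Finsupp.single a 1 + (α - Finsupp.single a 1) = α := by
  rw [add_tsub_cancel_of_le]
  rw [Finsupp.single_le_iff]
  omega

/-- A site of largest modulus can be removed from a nonzero pair of multi-indices. -/
theorem exists_largest {α β : MIdx} (h : α + β ≠ 0) :
    ∃ (a σ : ℤ) (ρ τ : MIdx), (σ = 1 ∨ σ = -1) ∧
      α + β = Finsupp.single a 1 + (ρ + τ) ∧
      midxDiff α β = Finsupp.single a σ + midxDiff ρ τ ∧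
      ∀ s, (α + β) s ≠ 0 → |s| ≤ |a| := by
  obtain ⟨a, ha, hmax⟩ := Finset.exists_max_image (α + β).support (fun s => |s|)
    (Finsupp.support_nonempty_iff.mpr h)
  have hmax' : ∀ s, (α + β) s ≠ 0 → |s| ≤ |a| := fun s hs =>
    hmax s (Finsupp.mem_support_iff.mpr hs)
  by_cases hα : α a = 0
  · have hβ : β a ≠ 0 := by
      rw [Finsupp.mem_support_iff, Finsupp.add_apply] at ha
      omega
    refine ⟨a, -1, α, β - Finsupp.single a 1, Or.inr rfl, ?_, ?_, hmax'⟩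
    · rw [add_left_comm, single_add_tsub hβ]
    · rw [← midxDiff_add_single_right, single_add_tsub hβ]
  · refine ⟨a, 1, α - Finsupp.single a 1, β, Or.inl rfl, ?_, ?_, hmax'⟩
    · rw [← add_assoc, single_add_tsub hα]
    · rw [← midxDiff_add_single_left, single_add_tsub hα]

/-- `α + β = e_a + e_b + (ρ + τ)`, where `a` and `b` are the sites of largest modulus and `σ`, `σ'` are
the signs with which they enter in `α - β`. -/
structure LargestPair (α β : MIdx) (a b σ σ' : ℤ) (ρ τ : MIdx) : Prop where
  sign_fst : σ = 1 ∨ σ = -1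
  sign_snd : σ' = 1 ∨ σ' = -1
  add_eq : α + β = Finsupp.single a 1 + (Finsupp.single b 1 + (ρ + τ))
  diff_eq : midxDiff α β = Finsupp.single a σ + (Finsupp.single b σ' + midxDiff ρ τ)
  le_fst : ∀ s, (α + β) s ≠ 0 → |s| ≤ |a|
  le_snd : ∀ s, (ρ + τ) s ≠ 0 → |s| ≤ |b|

theorem exists_largestPair {α β : MIdx} (h : 2 ≤ midxSize (α + β)) :
    ∃ a b σ σ' ρ τ, LargestPair α β a b σ σ' ρ τ := by
  have h0 : α + β ≠ 0 := by
    rintro h0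
    simp [h0, midxSize] at h
  obtain ⟨a, σ, ρ, τ, hσ, h1, h2, h3⟩ := exists_largest h0
  have h0' : ρ + τ ≠ 0 := by
    rintro h0
    rw [h1, h0] at h
    simp [midxSize] at h
  obtain ⟨b, σ', ρ', τ', hσ', h1', h2', h3'⟩ := exists_largest h0'
  exact ⟨a, b, σ, σ', ρ', τ', hσ, hσ', by rw [h1, h1'], by rw [h2, h2'], h3, fun s hs =>
    h3' s (by rw [h1', Finsupp.add_apply]; omega)⟩

/-! ### The two largest sites under conservation of momentum and small energy -/

namespace LargestPair

variable {α β ρ τ : MIdx} {a b σ σ' : ℤ}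

theorem abs_snd_le (h : LargestPair α β a b σ σ' ρ τ) : |b| ≤ |a| :=
  h.le_fst b (by rw [h.add_eq]; simp)

theorem size_eq (h : LargestPair α β a b σ σ' ρ τ) :
    midxSize (α + β) = 2 + midxSize (ρ + τ) := by
  rw [h.add_eq, midxSize_add, midxSize_add _ (ρ + τ)]
  simp only [midxSize, Finsupp.sum_single_index]
  ring

theorem logWeight_eq (h : LargestPair α β a b σ σ' ρ τ) :
    logWeight (α + β) = Real.log (jj a) + Real.log (jj b) + logWeight (ρ + τ) := by
  rw [h.add_eq, logWeight_add, logWeight_add _ (ρ + τ), logWeight_single, logWeight_single]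
  ring

theorem momentum_eq (h : LargestPair α β a b σ σ' ρ τ) :
    momentum (midxDiff α β) = a * σ + b * σ' + momentum (midxDiff ρ τ) := by
  rw [h.diff_eq, momentum_add, momentum_add, momentum_single, momentum_single]
  ring

theorem energy_eq (h : LargestPair α β a b σ σ' ρ τ) :
    energy (midxDiff α β) = a ^ 2 * σ + b ^ 2 * σ' + energy (midxDiff ρ τ) := by
  rw [h.diff_eq, energy_add, energy_add, energy_single, energy_single]
  ring

/-- By the conservation of momentum the largest site is controlled by the other ones. -/
theorem jj_fst_le (h : LargestPair α β a b σ σ' ρ τ) (hP : momentum (midxDiff α β) = 0) :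
    jj a ≤ jj b * (1 + midxSize (ρ + τ)) := by
  have h1 : |(momentum (midxDiff ρ τ) : ℝ)| ≤ midxSize (ρ + τ) * jj b := by
    refine (abs_momentum_le ρ τ).trans ?_
    rw [cast_midxSize, Finsupp.sum_mul]
    refine Finset.sum_le_sum fun s hs => mul_le_mul_of_nonneg_left ?_ (Nat.cast_nonneg _)
    have := h.le_snd s (Finsupp.mem_support_iff.mp hs)
    exact le_trans (by exact_mod_cast this) (abs_le_jj b)
  have h2 : |(a : ℝ)| ≤ |(b : ℝ)| + |(momentum (midxDiff ρ τ) : ℝ)| := by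
    have h3 := h.momentum_eq
    rw [hP] at h3
    have h4 : |a| ≤ |b| + |momentum (midxDiff ρ τ)| := by
      rcases h.sign_fst with rfl | rfl <;> rcases h.sign_snd with rfl | rfl <;>
        rcases abs_cases a with h5 | h5 <;> rcases abs_cases b with h6 | h6 <;>
        rcases abs_cases (momentum (midxDiff ρ τ)) with h7 | h7 <;> omega
    exact_mod_cast h4
  have h5 : (0 : ℝ) ≤ midxSize (ρ + τ) := Nat.cast_nonneg _
  refine max_le ?_ ?_
  · nlinarith [two_le_jj b]
  · linarith [abs_le_jj b]

theorem log_jj_fst_le (h : LargestPair α β a b σ σ' ρ τ) (hP : momentum (midxDiff α β) = 0) :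
    Real.log (jj a) ≤ Real.log (jj b) + Real.log (1 + midxSize (ρ + τ)) := by
  have h5 : (0 : ℝ) ≤ midxSize (ρ + τ) := Nat.cast_nonneg _
  rw [← Real.log_mul (jj_pos b).ne' (by linarith)]
  exact Real.log_le_log (jj_pos a) (h.jj_fst_le hP)

/-- Since `β j ≠ 0`, the site `j` is at most `a` in modulus; and `log ⌊a⌋ + log ⌊b⌋ - 2 log ⌊a⌋ =
log ⌊b⌋ - log ⌊a⌋` is bounded below by momentum. -/
theorem logWeight_gain (h : LargestPair α β a b σ σ' ρ τ) (hP : momentum (midxDiff α β) = 0)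
    {j : ℤ} (hj : β j ≠ 0) :
    logWeight (ρ + τ) - Real.log (1 + midxSize (ρ + τ)) ≤
      logWeight (α + β) - 2 * Real.log (jj j) := by
  have h1 : Real.log (jj j) ≤ Real.log (jj a) :=
    Real.log_le_log (jj_pos j) (jj_mono (h.le_fst j (by rw [Finsupp.add_apply]; omega)))
  have h2 := h.logWeight_eq
  have h3 := h.log_jj_fst_le hP
  linarith

theorem gain_nonneg (h : LargestPair α β a b σ σ' ρ τ) (hP : momentum (midxDiff α β) = 0)
    {j : ℤ} (hj : β j ≠ 0) : 0 ≤ logWeight (α + β) - 2 * Real.log (jj j) := by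
  have h1 := h.logWeight_gain hP hj
  have h2 := Real.log_le_log (by positivity) (one_add_midxSize_le (ρ + τ))
  rw [Real.log_exp] at h2
  linarith

theorem half_le_gain (h : LargestPair α β a b σ σ' ρ τ) (hP : momentum (midxDiff α β) = 0)
    {j : ℤ} (hj : β j ≠ 0) :
    logWeight (ρ + τ) / 2 - 2 ≤ logWeight (α + β) - 2 * Real.log (jj j) := by
  have h1 := h.logWeight_gain hP hj
  have h2 := Real.log_le_log (by positivity) (one_add_midxSize_le_half (ρ + τ))
  rw [Real.log_mul (by norm_num) (Real.exp_pos _).ne', Real.log_exp] at h2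
  have h3 := Real.log_le_sub_one_of_pos (show (0 : ℝ) < 3 by norm_num)
  linarith

/-- If the quadratic energy is small, then the two largest sites either cancel or are controlled by
the other ones. -/
theorem cancel_or_log_le (h : LargestPair α β a b σ σ' ρ τ)
    (hP : momentum (midxDiff α β) = 0)
    (hQ : |(energy (midxDiff α β) : ℝ)| < lOne (midxDiff α β)) :
    midxDiff α β = midxDiff ρ τ ∨
      Real.log (jj a) ≤ 1 + 3 * logWeight (ρ + τ) ∧
      Real.log (jj b) ≤ 1 + 3 * logWeight (ρ + τ) := by
  -- `A` dominates momentum, energy and number of the remaining sites at once; the exponent 3 below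
  -- comes from `1 + x² ≤ x³` for `x ≥ 2`.
  set A : ℝ := (ρ + τ).sum fun s n => (n : ℝ) * jj s ^ 2 with hA
  have hAT : 1 + A ≤ Real.exp (3 * logWeight (ρ + τ)) := by
    refine one_add_sum_le_exp_logWeight (fun s => by positivity) (fun s => ?_) _
    rw [mul_comm, Real.exp_mul, Real.exp_log (jj_pos s)]
    norm_cast
    nlinarith [two_le_jj s, sq_nonneg (jj s)]
  have hA0 : 0 ≤ A := Finset.sum_nonneg fun s _ => by positivity
  have hQR : |(energy (midxDiff ρ τ) : ℝ)| ≤ A := abs_energy_le ρ τ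
  have hPR : |(momentum (midxDiff ρ τ) : ℝ)| ≤ A := by
    refine (abs_momentum_le ρ τ).trans (Finset.sum_le_sum fun s _ => ?_)
    refine mul_le_mul_of_nonneg_left ((abs_le_jj s).trans ?_) (Nat.cast_nonneg _)
    nlinarith [two_le_jj s]
  have hL : |(energy (midxDiff α β) : ℝ)| ≤ 2 + A := by
    refine hQ.le.trans ((lOne_midxDiff_le α β).trans ?_)
    rw [h.size_eq, Nat.cast_add, cast_midxSize]
    refine add_le_add (by norm_num) (Finset.sum_le_sum fun s _ => ?_)
    refine le_mul_of_one_le_right (Nat.cast_nonneg _) ?_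
    nlinarith [two_le_jj s]
  have key : |(a : ℝ)| ≤ 2 * (1 + A) → Real.log (jj a) ≤ 1 + 3 * logWeight (ρ + τ) ∧
      Real.log (jj b) ≤ 1 + 3 * logWeight (ρ + τ) := by
    intro ha
    have h1 : jj a ≤ 2 * Real.exp (3 * logWeight (ρ + τ)) := max_le (by linarith) (by linarith)
    have h2 : Real.log (jj a) ≤ 1 + 3 * logWeight (ρ + τ) := by
      have := Real.log_le_log (jj_pos a) h1
      rw [Real.log_mul two_ne_zero (Real.exp_pos _).ne', Real.log_exp] at this
      linarith [Real.log_two_lt_d9]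
    exact ⟨h2, (Real.log_le_log (jj_pos b) (jj_mono h.abs_snd_le)).trans h2⟩
  have hE := h.energy_eq
  have hM := h.momentum_eq
  rw [hP] at hM
  have hE' : (energy (midxDiff α β) : ℝ) = a ^ 2 * σ + b ^ 2 * σ' + energy (midxDiff ρ τ) := by
    exact_mod_cast hE
  have hM' : (0 : ℝ) = a * σ + b * σ' + momentum (midxDiff ρ τ) := by exact_mod_cast hM
  rw [abs_le] at hQR hPR hL
  -- Equal signs: the energy controls `a² + b²`, and `|a| ≤ a²` for an integer.
  have sq_case : (a : ℝ) ^ 2 + b ^ 2 ≤ 2 * (1 + A) → |(a : ℝ)| ≤ 2 * (1 + A) := by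
    intro h1
    rcases eq_or_ne a 0 with rfl | ha
    · simp; linarith
    · have : (1 : ℝ) ≤ |(a : ℝ)| := by exact_mod_cast Int.one_le_abs ha
      nlinarith [sq_abs (a : ℝ), sq_nonneg (b : ℝ)]
  -- Opposite signs: momentum controls `a - b` and energy controls `a² - b²`. As `|a - b| ≥ 1` for
  -- distinct integers, `a + b` is controlled as well. If `a = b`, the two sites cancel in `ℓ`.
  have diff_case : a ≠ b → |(a : ℝ) - b| ≤ A → |(a : ℝ) ^ 2 - b ^ 2| ≤ 2 * (1 + A) →
      |(a : ℝ)| ≤ 2 * (1 + A) := by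
    intro hab h1 h2
    have h3 : (1 : ℝ) ≤ |(a : ℝ) - b| := by
      exact_mod_cast Int.one_le_abs (sub_ne_zero.mpr hab)
    rw [sq_sub_sq, abs_mul] at h2
    have h4 : |(a : ℝ) + b| ≤ 2 * (1 + A) :=
      (le_mul_of_one_le_right (abs_nonneg _) h3).trans h2
    rw [abs_le] at h1 h4 ⊢
    constructor <;> linarith [h1.1, h1.2, h4.1, h4.2]
  have hdiff := h.diff_eq
  rcases h.sign_fst with rfl | rfl <;> rcases h.sign_snd with rfl | rfl
  · right; refine key (sq_case ?_); push_cast at hE'; linarith [hQR.1, hL.2]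
  · by_cases hab : a = b
    · left
      rw [hdiff, hab, ← add_assoc, ← Finsupp.single_add]
      simp
    · right
      push_cast at hE' hM'
      refine key (diff_case hab ?_ ?_) <;> rw [abs_le] <;> constructor <;>
        linarith [hQR.1, hQR.2, hL.1, hL.2, hPR.1, hPR.2]
  · by_cases hab : a = b
    · left
      rw [hdiff, hab, ← add_assoc, ← Finsupp.single_add]
      simp
    · right
      push_cast at hE' hM'
      refine key (diff_case hab ?_ ?_) <;> rw [abs_le] <;> constructor <;>
        linarith [hQR.1, hQR.2, hL.1, hL.2, hPR.1, hPR.2]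
  · right; refine key (sq_case ?_); push_cast at hE'; linarith [hQR.2, hL.1]

end LargestPair

/-! ### Admissible sites -/

theorem IsAdmissibleSeq.log_pow_le {istar η : ℝ} {s : ℝ → ℝ} (h : IsAdmissibleSeq istar η s)
    {n : ℕ} (hn : istar ≤ n) : Real.log n ^ (1 + η) ≤ Real.log (s n) := by
  rw [Real.le_log_iff_exp_le ((Real.exp_pos _).trans_le (h.growth n hn))]
  exact h.growth n hn

theorem IsAdmissible.eta_mem {istar η : ℝ} {S₀ : Finset ℤ} {idx : ℤ → ℕ} {S : Set ℤ}
    (h : IsAdmissible istar η S₀ idx S) : 1 < η ∧ η ≤ 2 := by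
  obtain ⟨B, s, ⟨σ, hσ⟩, -, hs, -⟩ := h
  exact ⟨(hs σ hσ).one_lt_eta, (hs σ hσ).eta_le_two⟩

theorem IsAdmissibleSeq.abs_eq {istar η : ℝ} {s : ℝ → ℝ} (h : IsAdmissibleSeq istar η s)
    {σ j : ℤ} {n : ℕ} (hσ : σ = 1 ∨ σ = -1) (hj : (j : ℝ) = σ * s n) : |(j : ℝ)| = s n := by
  have h0 := h.nonneg n (Nat.cast_nonneg n)
  rw [hj, abs_mul, abs_of_nonneg h0]
  rcases hσ with rfl | rfl <;> simp

/-- Apart from finitely many, the sites have large index and are much larger than their index. -/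
theorem IsAdmissible.exists_finset {istar η : ℝ} {S₀ : Finset ℤ} {idx : ℤ → ℕ} {S : Set ℤ}
    (h : IsAdmissible istar η S₀ idx S) {N : ℕ} (hN : istar ≤ N) :
    ∃ F : Finset ℤ, F.card ≤ S₀.card + 2 * N ∧ ∀ j ∈ S, (j ∈ F ∧ (j ∈ S₀ ∨ idx j < N)) ∨
      (N ≤ idx j ∧ Real.log (idx j) ^ (1 + η) ≤ Real.log (jj j)) := by
  classical
  obtain ⟨B, s, -, hB, hs, rfl, hidx⟩ := h
  -- Floors turn the real values `± s(n)` into sites. A sign that does not occur only contributes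
  -- superfluous points.
  refine ⟨S₀ ∪ ((Finset.range N).image (fun n : ℕ => ⌊s 1 n⌋) ∪
    (Finset.range N).image (fun n : ℕ => ⌊-s (-1) n⌋)), ?_, ?_⟩
  · refine (Finset.card_union_le _ _).trans (Nat.add_le_add_left ?_ _)
    refine (Finset.card_union_le _ _).trans ?_
    have h1 := Finset.card_image_le (s := Finset.range N) (f := fun n : ℕ => ⌊s 1 n⌋)
    have h2 := Finset.card_image_le (s := Finset.range N) (f := fun n : ℕ => ⌊-s (-1) n⌋)
    rw [Finset.card_range] at h1 h2
    omega
  · rintro j (hj | ⟨σ, hσ, n, hj⟩)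
    · exact Or.inl ⟨Finset.mem_union_left _ hj, Or.inl hj⟩
    by_cases hj0 : j ∈ S₀
    · exact Or.inl ⟨Finset.mem_union_left _ hj0, Or.inl hj0⟩
    have hn := hidx σ hσ n j hj hj0
    rw [hn]
    rcases lt_or_ge n N with hlt | hge
    · refine Or.inl ⟨Finset.mem_union_right _ ?_, Or.inr hlt⟩
      rcases hB hσ with rfl | rfl
      · refine Finset.mem_union_left _ (Finset.mem_image.mpr ⟨n, Finset.mem_range.mpr hlt, ?_⟩)
        rw [← Int.floor_intCast (R := ℝ) j, hj]
        simp
      · refine Finset.mem_union_right _ (Finset.mem_image.mpr ⟨n, Finset.mem_range.mpr hlt, ?_⟩)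
        rw [← Int.floor_intCast (R := ℝ) j, hj]
        simp
    · refine Or.inr ⟨hge, ?_⟩
      have hNn : istar ≤ n := hN.trans (by exact_mod_cast hge)
      refine ((hs σ hσ).log_pow_le hNn).trans (Real.log_le_log ?_ ?_)
      · exact (Real.exp_pos _).trans_le ((hs σ hσ).growth n hNn)
      · rw [← IsAdmissibleSeq.abs_eq (hs σ hσ) (hB hσ) hj]
        exact abs_le_jj j

/-- The logarithm of `1 + x ⟨i(s)⟩` at the sites `s ∈ S`. -/
noncomputable def siteLog (S : Set ℤ) (idx : ℤ → ℕ) (s : ℤ) (x : ℝ) : ℝ :=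
  open Classical in if s ∈ S then Real.log (1 + |x| * max 1 (idx s : ℝ)) else 0

section SiteLog

variable {S : Set ℤ} {idx : ℤ → ℕ}

theorem siteLog_zero (s : ℤ) : siteLog S idx s 0 = 0 := by simp [siteLog]

theorem siteLog_nonneg (s : ℤ) (x : ℝ) : 0 ≤ siteLog S idx s x := by
  unfold siteLog
  split_ifs
  · exact Real.log_nonneg (le_add_of_nonneg_right (by positivity))
  · rfl

theorem siteLog_mono (s : ℤ) {x y : ℝ} (h : |x| ≤ |y|) : siteLog S idx s x ≤ siteLog S idx s y := by
  unfold siteLog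
  split_ifs
  · exact Real.log_le_log (by positivity) (by gcongr)
  · rfl

theorem siteLog_add_le (s : ℤ) (x y : ℝ) :
    siteLog S idx s (x + y) ≤ siteLog S idx s x + siteLog S idx s y := by
  unfold siteLog
  split_ifs
  · rw [← Real.log_mul (by positivity) (by positivity)]
    refine Real.log_le_log (by positivity) ?_
    set z : ℝ := max 1 (idx s : ℝ)
    have hz : 0 ≤ z := zero_le_one.trans (le_max_left _ _)
    nlinarith [mul_le_mul_of_nonneg_right (abs_add_le x y) hz,
      mul_nonneg (mul_nonneg (abs_nonneg x) hz) (mul_nonneg (abs_nonneg y) hz)]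
  · simp

/-- The sum of the `log (1 + |ℓ_s| ⟨i(s)⟩)` over `s ∈ S`. -/
noncomputable def siteLogSum (S : Set ℤ) (idx : ℤ → ℕ) (l : ℤ →₀ ℤ) : ℝ :=
  l.sum fun s n => siteLog S idx s n

theorem siteLogSum_add_le (l k : ℤ →₀ ℤ) :
    siteLogSum S idx (l + k) ≤ siteLogSum S idx l + siteLogSum S idx k :=
  sum_add_le_of_subadditive (fun s => by rw [Int.cast_zero, siteLog_zero])
    (fun s x y => by rw [Int.cast_add]; exact siteLog_add_le s _ _) l k

theorem siteLogSum_nonneg (l : ℤ →₀ ℤ) : 0 ≤ siteLogSum S idx l :=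
  Finset.sum_nonneg fun s _ => siteLog_nonneg s _

theorem siteLogSum_single (a n : ℤ) : siteLogSum S idx (Finsupp.single a n) = siteLog S idx a n := by
  unfold siteLogSum
  rw [Finsupp.sum_single_index]
  rw [Int.cast_zero, siteLog_zero]

/-- Factor by factor, `1 + x²z² ≤ (1 + xz)²`; the power `3/2` then becomes the cube. -/
theorem exp_neg_siteLogSum_le_diophWeight (l : ℤ →₀ ℤ) :
    Real.exp (-(3 * siteLogSum S idx l)) ≤ diophWeight S idx l := by
  unfold siteLogSum diophWeight Finsupp.sum Finsupp.prod
  rw [Finset.mul_sum, ← Finset.sum_neg_distrib, Real.exp_sum]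
  refine Finset.prod_le_prod (fun s _ => (Real.exp_pos _).le) fun s _ => ?_
  unfold siteLog
  dsimp only
  split_ifs
  · set z : ℝ := max 1 (idx s : ℝ)
    have hz : 0 ≤ z := zero_le_one.trans (le_max_left _ _)
    have hx : 0 ≤ |(l s : ℝ)| * z := by positivity
    rw [Real.exp_neg, one_div]
    refine inv_anti₀ (by positivity) ?_
    rw [mul_comm (3 : ℝ), Real.exp_mul, Real.exp_log (by linarith)]
    calc (1 + |(l s : ℝ)| ^ 2 * z ^ 2) ^ (3 / 2 : ℝ)
        ≤ ((1 + |(l s : ℝ)| * z) ^ 2) ^ (3 / 2 : ℝ) :=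
          Real.rpow_le_rpow (by positivity) (by nlinarith) (by norm_num)
      _ = (1 + |(l s : ℝ)| * z) ^ (3 : ℝ) := by
          rw [← Real.rpow_natCast, ← Real.rpow_mul (by linarith)]
          norm_num
  · simp

theorem diophWeight_pos (l : ℤ →₀ ℤ) : 0 < diophWeight S idx l :=
  (Real.exp_pos _).trans_le (exp_neg_siteLogSum_le_diophWeight l)

end SiteLog

/-! ### The gain from the decay of the sequences -/

/-- The lower bound on `i` gives `(log i)^η ≥ 1152/δ`, so `lj ≥ (1152/δ) log i`. With `n, log i ≥
1`, `log (1 + n i) ≤ 1 + n + log i ≤ 3 n log i`, and `6 · 3 = 1152 / 64`. -/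
theorem six_log_le_of_large {η δ lj : ℝ} (hη : 1 < η) (hδ : 0 < δ) (hδ1 : δ < 1) {i n : ℕ}
    (hn : 1 ≤ n) (hi : Real.exp ((1152 / δ) ^ (1 / η)) ≤ i) (hl : Real.log i ^ (1 + η) ≤ lj) :
    6 * Real.log (1 + n * max 1 (i : ℝ)) ≤ δ / 64 * (n * lj) := by
  have hx1 : 1 ≤ 1152 / δ := by rw [le_div_iff₀ hδ]; linarith
  have hx : 1 ≤ (1152 / δ) ^ (1 / η) := Real.one_le_rpow hx1 (by positivity)
  have hipos : (0 : ℝ) < i := (Real.exp_pos _).trans_le hi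
  have hlog : (1152 / δ) ^ (1 / η) ≤ Real.log i := by
    rwa [Real.le_log_iff_exp_le hipos]
  have hlog1 : 1 ≤ Real.log i := hx.trans hlog
  have hpow : 1152 / δ ≤ Real.log i ^ η := by
    have h := Real.rpow_le_rpow (by positivity) hlog (show 0 ≤ η by linarith)
    rwa [← Real.rpow_mul (by positivity), one_div_mul_cancel (by positivity), Real.rpow_one] at h
  have hlj : Real.log i * (1152 / δ) ≤ lj := by
    refine le_trans ?_ hl
    rw [Real.rpow_add (by linarith), Real.rpow_one]
    exact mul_le_mul_of_nonneg_left hpow (by linarith)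
  have hi1 : (1 : ℝ) ≤ i := by exact_mod_cast Nat.one_le_iff_ne_zero.mpr (by rintro rfl; simp at hipos)
  have hn1 : (1 : ℝ) ≤ n := by exact_mod_cast hn
  rw [max_eq_right hi1]
  have h1 : Real.log (1 + n * (i : ℝ)) ≤ 1 + n + Real.log i := by
    have h2 : Real.log (1 + n * (i : ℝ)) ≤ Real.log (2 * (n * i)) :=
      Real.log_le_log (by positivity) (by nlinarith)
    rw [Real.log_mul (by norm_num) (by positivity), Real.log_mul (by positivity) hipos.ne'] at h2
    linarith [Real.log_two_lt_d9, Real.log_le_sub_one_of_pos (show (0 : ℝ) < n by linarith)]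
  have h3 : δ / 64 * (n * (Real.log i * (1152 / δ))) ≤ δ / 64 * (n * lj) := by gcongr
  have h4 : δ / 64 * (n * (Real.log i * (1152 / δ))) = 18 * (n * Real.log i) := by
    field_simp; norm_num
  nlinarith [mul_nonneg (sub_nonneg.mpr hn1) (sub_nonneg.mpr hlog1)]

/-- The logarithm of a product is at most the sum of the factors. The factor `δ n / 768` is chosen
so that six times it is `(δ/64) (n/2)`, which `lj ≥ 1/2` pays for; the other factor is the fixed
loss, with `6 · 1536 ≤ 10000`. -/
theorem six_log_le_of_small {δ lj z Z : ℝ} (hδ : 0 < δ) (hδ1 : δ < 1) {n : ℕ}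
    (hn : 1 ≤ n) (hz : 1 ≤ z) (hZ : z ≤ Z) (hl : 1 / 2 ≤ lj) :
    6 * Real.log (1 + n * z) ≤ δ / 64 * (n * lj) + 10000 * Z / δ := by
  have hn1 : (1 : ℝ) ≤ n := by exact_mod_cast hn
  have h1 : Real.log (1 + n * z) ≤ Real.log (δ / 768 * n * (1536 * Z / δ)) := by
    refine Real.log_le_log (by positivity) ?_
    have : δ / 768 * n * (1536 * Z / δ) = 2 * (n * Z) := by field_simp; ring
    rw [this]
    nlinarith
  have hZ0 : 0 < Z := by linarith
  rw [Real.log_mul (by positivity) (by positivity)] at h1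
  have h2 := Real.log_le_sub_one_of_pos (show 0 < δ / 768 * n by positivity)
  have h3 := Real.log_le_sub_one_of_pos (show 0 < 1536 * Z / δ by positivity)
  have h4 : δ / 64 * (n * (1 / 2)) ≤ δ / 64 * (n * lj) := by gcongr
  have h5 : 1536 * Z / δ = 1536 * (Z / δ) := by ring
  have h6 : 10000 * Z / δ = 10000 * (Z / δ) := by ring
  have h7 : 0 < Z / δ := by positivity
  rw [h5] at h1 h3
  rw [h6]
  linarith

/-- The index from which on the sites compensate their small divisors. -/
noncomputable def cutoff (istar η δ : ℝ) : ℕ := ⌈max istar (Real.exp ((1152 / δ) ^ (1 / η)))⌉₊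

/-- The loss caused by a single site below the cutoff. -/
noncomputable def siteLoss (istar : ℝ) (M₀ : ℕ) (η δ : ℝ) : ℝ :=
  10000 * (1 + M₀ + cutoff istar η δ : ℝ) / δ

theorem siteLoss_nonneg (istar : ℝ) (M₀ : ℕ) (η : ℝ) {δ : ℝ} (hδ : 0 < δ) :
    0 ≤ siteLoss istar M₀ η δ := by
  unfold siteLoss
  positivity

section Gain

variable {istar η δ : ℝ} {S₀ : Finset ℤ} {idx : ℤ → ℕ} {S : Set ℤ} {N₀ M₀ : ℕ}

theorem IsAdmissible.exists_siteLog_le (h : IsAdmissible istar η S₀ idx S) (hN₀ : S₀.card ≤ N₀)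
    (hM₀ : ∀ j ∈ S₀, idx j ≤ M₀) (hδ : 0 < δ) (hδ1 : δ < 1) :
    ∃ F : Finset ℤ, F.card ≤ N₀ + 2 * cutoff istar η δ ∧ ∀ (s : ℤ) (n : ℕ), n ≠ 0 →
      6 * siteLog S idx s n ≤ δ / 64 * (n * Real.log (jj s)) +
        if s ∈ F then siteLoss istar M₀ η δ else 0 := by
  have hN := Nat.le_ceil (max istar (Real.exp ((1152 / δ) ^ (1 / η))))
  obtain ⟨F, hF, hFS⟩ := h.exists_finset ((le_max_left _ _).trans hN)
  refine ⟨F, hF.trans (Nat.add_le_add_right hN₀ _), fun s n hn => ?_⟩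
  have hn1 : 1 ≤ n := Nat.one_le_iff_ne_zero.mpr hn
  have hjj := half_le_log_jj s
  have h0 : 0 ≤ δ / 64 * (n * Real.log (jj s)) :=
    mul_nonneg (by positivity) (mul_nonneg (Nat.cast_nonneg _) (by linarith))
  have hE := siteLoss_nonneg istar M₀ η hδ
  unfold siteLog
  by_cases hs : s ∈ S
  · rw [if_pos hs, abs_of_nonneg (Nat.cast_nonneg n)]
    rcases hFS s hs with ⟨h1, h2⟩ | ⟨h1, h2⟩
    · rw [if_pos h1]
      refine six_log_le_of_small hδ hδ1 hn1 (le_max_left _ _) ?_ hjj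
      have h3 : idx s ≤ M₀ + cutoff istar η δ := by
        rcases h2 with h2 | h2
        · exact (hM₀ s h2).trans (Nat.le_add_right _ _)
        · exact h2.le.trans (Nat.le_add_left _ _)
      have h4 : (idx s : ℝ) ≤ M₀ + cutoff istar η δ := by exact_mod_cast h3
      have h5 : (0 : ℝ) ≤ idx s := Nat.cast_nonneg _
      exact max_le (by linarith) (by linarith)
    · have h3 := six_log_le_of_large h.eta_mem.1 hδ hδ1 hn1
        ((le_max_right _ _).trans (hN.trans (by exact_mod_cast h1))) h2
      split_ifs <;> linarith
  · rw [if_neg hs]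
    split_ifs <;> linarith

theorem siteLogSum_midxDiff_le (ρ τ : MIdx) :
    siteLogSum S idx (midxDiff ρ τ) ≤ (ρ + τ).sum fun s n => siteLog S idx s n :=
  midxDiff_sum_le (fun s n => siteLog_nonneg s _) fun s n m hnm => by
    refine siteLog_mono s ?_
    rw [Nat.abs_cast]
    exact abs_cast_le_cast hnm

/-- For small quadratic energy, the inverse of the Diophantine weight is compensated by the third and
the following largest sites. -/
theorem IsAdmissible.siteLogSum_le (h : IsAdmissible istar η S₀ idx S) (hN₀ : S₀.card ≤ N₀)
    (hM₀ : ∀ j ∈ S₀, idx j ≤ M₀) (hδ : 0 < δ) (hδ1 : δ < 1)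
    {α β ρ τ : MIdx} {a b σ σ' : ℤ} (hp : LargestPair α β a b σ σ' ρ τ)
    (hP : momentum (midxDiff α β) = 0)
    (hQ : |(energy (midxDiff α β) : ℝ)| < lOne (midxDiff α β)) :
    6 * siteLogSum S idx (midxDiff α β) ≤ δ / 8 * logWeight (ρ + τ) + 1 +
      (N₀ + 2 * cutoff istar η δ + 2) * siteLoss istar M₀ η δ := by
  obtain ⟨F, hF, hle⟩ := h.exists_siteLog_le hN₀ hM₀ hδ hδ1
  set E := siteLoss istar M₀ η δ
  have hE : 0 ≤ E := siteLoss_nonneg istar M₀ η hδ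
  have hW := logWeight_nonneg (ρ + τ)
  have hrest : 6 * siteLogSum S idx (midxDiff ρ τ) ≤
      δ / 64 * logWeight (ρ + τ) + (N₀ + 2 * cutoff istar η δ) * E := by
    have h1 : 6 * siteLogSum S idx (midxDiff ρ τ) ≤
        6 * (ρ + τ).sum fun s n => siteLog S idx s n :=
      mul_le_mul_of_nonneg_left (siteLogSum_midxDiff_le ρ τ) (by norm_num)
    refine h1.trans ?_
    unfold logWeight Finsupp.sum
    rw [Finset.mul_sum, Finset.mul_sum]
    refine (Finset.sum_le_sum fun s hs => hle s _ (Finsupp.mem_support_iff.mp hs)).trans ?_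
    rw [Finset.sum_add_distrib]
    refine add_le_add_right ?_ _
    rw [← Finset.sum_filter, Finset.sum_const, nsmul_eq_mul]
    refine mul_le_mul_of_nonneg_right ?_ hE
    have h2 : ((ρ + τ).support.filter (· ∈ F)).card ≤ N₀ + 2 * cutoff istar η δ :=
      (Finset.card_le_card fun s hs => (Finset.mem_filter.mp hs).2).trans hF
    exact_mod_cast h2
  -- If the largest sites do not cancel, each costs `δ/64 (1 + 3R)` plus one site loss, where `R` is
  -- the remaining weight. In all, `1 + 3 + 3 = 7` parts out of 64 are used, below `δ/8`.
  rcases hp.cancel_or_log_le hP hQ with heq | ⟨ha, hb⟩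
  · rw [heq]
    nlinarith [mul_nonneg hδ.le hW]
  · have hsingle : ∀ (c ν : ℤ), (ν = 1 ∨ ν = -1) →
        Real.log (jj c) ≤ 1 + 3 * logWeight (ρ + τ) →
        6 * siteLogSum S idx (Finsupp.single c ν) ≤
          δ / 64 * (1 + 3 * logWeight (ρ + τ)) + E := by
      intro c ν hν hc
      have h1 : siteLog S idx c ν = siteLog S idx c (1 : ℕ) := by
        unfold siteLog
        rcases hν with rfl | rfl <;> simp
      rw [siteLogSum_single, h1]
      have h2 := hle c 1 one_ne_zero
      have h3 : (if c ∈ F then E else 0) ≤ E := by split_ifs <;> linarith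
      have h4 := mul_le_mul_of_nonneg_left hc (show 0 ≤ δ / 64 by positivity)
      rw [Nat.cast_one, one_mul] at h2
      rw [Nat.cast_one]
      linarith
    have h1 := hsingle a σ hp.sign_fst ha
    have h2 := hsingle b σ' hp.sign_snd hb
    have h3 : siteLogSum S idx (midxDiff α β) ≤ siteLogSum S idx (Finsupp.single a σ) +
        (siteLogSum S idx (Finsupp.single b σ') + siteLogSum S idx (midxDiff ρ τ)) := by
      rw [hp.diff_eq]
      exact (siteLogSum_add_le _ _).trans (add_le_add_right (siteLogSum_add_le _ _) _)
    nlinarith [mul_nonneg hδ.le hW]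

end Gain

/-! ### The size of the Diophantine constant -/

theorem mem_dioph_bound {γ : ℝ} {S : Set ℤ} {idx : ℤ → ℕ} {ω : ℤ → ℝ} (hω : ω ∈ dioph γ S idx)
    {l : ℤ →₀ ℤ} (hl : l ≠ 0)
    (hn : (l.sum fun j n => open Classical in if j ∈ S then 0 else |n|) ≤ 2)
    (hP : momentum l = 0) (hM : (l.sum fun _ n => n) = 0) :
    γ * diophWeight S idx l ≤ |freqDot ω l| :=
  hω.2 l hl hn hP hM

theorem freqDot_sub_energy (ω : ℤ → ℝ) (l : ℤ →₀ ℤ) :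
    freqDot ω l - energy l = l.sum fun j n => (ω j - (j : ℝ) ^ 2) * n := by
  simp only [freqDot, energy, Finsupp.sum]
  push_cast
  rw [← Finset.sum_sub_distrib]
  exact Finset.sum_congr rfl fun _ _ => by ring

theorem abs_freqDot_sub_energy_le {ω : ℤ → ℝ} (hω : ω ∈ freqCube) (l : ℤ →₀ ℤ) :
    |freqDot ω l - energy l| ≤ lOne l / 2 := by
  rw [freqDot_sub_energy, lOne, Finsupp.sum, Finsupp.sum, Finset.sum_div]
  refine (Finset.abs_sum_le_sum_abs _ _).trans (Finset.sum_le_sum fun s _ => ?_)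
  rw [abs_mul]
  have := mul_le_mul_of_nonneg_right (hω s).le (abs_nonneg (l s : ℝ))
  linarith

theorem lOne_single (a n : ℤ) : lOne (Finsupp.single a n) = |(n : ℝ)| := by simp [lOne]

theorem lOne_add_le (l k : ℤ →₀ ℤ) : lOne (l + k) ≤ lOne l + lOne k :=
  sum_add_le_of_subadditive (by simp) (fun s x y => by rw [Int.cast_add]; exact abs_add_le _ _) l k

/-- The integer vector `3 e_a - 3 e_b + e_{2b-a} - e_{2a-b}`, which is resonant for the frequencies `j²`. -/
noncomputable def resonance (a b : ℤ) : ℤ →₀ ℤ :=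
  Finsupp.single a 3 + (Finsupp.single b (-3) +
    (Finsupp.single (2 * b - a) 1 + Finsupp.single (2 * a - b) (-1)))

theorem momentum_resonance (a b : ℤ) : momentum (resonance a b) = 0 := by
  simp only [resonance, momentum_add, momentum_single]
  ring

theorem energy_resonance (a b : ℤ) : energy (resonance a b) = 0 := by
  simp only [resonance, energy_add, energy_single]
  ring

theorem mass_resonance (a b : ℤ) : ((resonance a b).sum fun _ n => n) = 0 := by
  have hadd (l k : ℤ →₀ ℤ) :
      ((l + k).sum fun _ n => n) = (l.sum fun _ n => n) + k.sum fun _ n => n :=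
    Finsupp.sum_add_index' (by simp) (by simp)
  simp only [resonance, hadd, Finsupp.sum_single_index]
  norm_num

theorem resonance_ne_zero {a b : ℤ} (hab : a ≠ b) : resonance a b ≠ 0 := by
  intro h
  have h1 := DFunLike.congr_fun h a
  simp only [resonance, Finsupp.add_apply, Finsupp.single_apply, Finsupp.coe_zero,
    Pi.zero_apply] at h1
  split_ifs at h1 <;> omega

theorem lOne_resonance_le (a b : ℤ) : lOne (resonance a b) ≤ 8 := by
  have h1 := lOne_add_le (Finsupp.single a 3) (Finsupp.single b (-3) +
    (Finsupp.single (2 * b - a) 1 + Finsupp.single (2 * a - b) (-1)))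
  have h2 := lOne_add_le (Finsupp.single b (-3))
    (Finsupp.single (2 * b - a) 1 + Finsupp.single (2 * a - b) (-1))
  have h3 := lOne_add_le (Finsupp.single (2 * b - a) 1) (Finsupp.single (2 * a - b) (-1))
  simp only [lOne_single] at h1 h2 h3
  have h4 : |((3 : ℤ) : ℝ)| = 3 := by norm_num
  have h5 : |((-3 : ℤ) : ℝ)| = 3 := by norm_num
  have h6 : |((1 : ℤ) : ℝ)| = 1 := by norm_num
  have h7 : |((-1 : ℤ) : ℝ)| = 1 := by norm_num
  unfold resonance
  linarith

theorem normal_resonance_le {S : Set ℤ} {a b : ℤ} (ha : a ∈ S) (hb : b ∈ S) :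
    ((resonance a b).sum fun j n => open Classical in if j ∈ S then 0 else |n|) ≤ 2 := by
  classical
  set φ : ℤ → ℤ → ℤ := fun j n => if j ∈ S then 0 else |n| with hφ
  have hadd := sum_add_le_of_subadditive (φ := φ) (fun s => by simp [hφ])
    (fun s x y => by
      simp only [hφ]
      split_ifs
      · simp
      · exact abs_add_le _ _)
  have hs (c n : ℤ) : (Finsupp.single c n).sum φ = φ c n :=
    Finsupp.sum_single_index (by simp [hφ])
  have h6 : φ a 3 = 0 := if_pos ha
  have h7 : φ b (-3) = 0 := if_pos hb
  have h1 := hadd (Finsupp.single a 3) (Finsupp.single b (-3) +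
    (Finsupp.single (2 * b - a) 1 + Finsupp.single (2 * a - b) (-1)))
  have h2 := hadd (Finsupp.single b (-3))
    (Finsupp.single (2 * b - a) 1 + Finsupp.single (2 * a - b) (-1))
  have h3 := hadd (Finsupp.single (2 * b - a) 1) (Finsupp.single (2 * a - b) (-1))
  rw [hs, h6] at h1
  rw [hs, h7] at h2
  rw [hs, hs] at h3
  have h4 : φ (2 * b - a) 1 ≤ 1 := by simp only [hφ]; split_ifs <;> simp
  have h5 : φ (2 * a - b) (-1) ≤ 1 := by simp only [hφ]; split_ifs <;> simp
  unfold resonance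
  have h8 : (Finsupp.single a 3 + (Finsupp.single b (-3) +
      (Finsupp.single (2 * b - a) 1 + Finsupp.single (2 * a - b) (-1)))).sum φ ≤ 2 := by linarith
  convert h8

/-- Take `a`, `b` to be the images of 0 and 1 in the branch with smallest `s 1`. All four points
have modulus at most `2 s(1)`, and for every branch `2 s(1) ≤ 2 s(K) ≤ s(2K)` with `K = ⌈istar⌉₊`;
monotonicity then bounds the indices by `2K`. -/
theorem IsAdmissible.exists_pair {istar η : ℝ} {S₀ : Finset ℤ} {idx : ℤ → ℕ} {S : Set ℤ} {M₀ : ℕ}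
    (h : IsAdmissible istar η S₀ idx S) (hM₀ : ∀ j ∈ S₀, idx j ≤ M₀) :
    ∃ a b : ℤ, a ∈ S ∧ b ∈ S ∧ a ≠ b ∧ ∀ j ∈ S, j = a ∨ j = b ∨ j = 2 * b - a ∨ j = 2 * a - b →
      idx j ≤ M₀ + 2 * ⌈istar⌉₊ := by
  obtain ⟨B, s, hBne, hB, hs, rfl, hidx⟩ := h
  obtain ⟨σ, hσ, hmin⟩ := Set.exists_min_image B (fun σ => s σ 1)
    (Set.Finite.subset (Set.toFinite _) hB) hBne
  have hσ' := hB hσ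
  obtain ⟨m0, h0⟩ := (hs σ hσ).nat_values 0
  obtain ⟨m1, h1⟩ := (hs σ hσ).nat_values 1
  rw [Nat.cast_zero] at h0
  rw [Nat.cast_one] at h1
  have hlt : m0 < m1 := by
    have := (hs σ hσ).strictMono (show (0 : ℝ) ∈ Set.Ici 0 by simp)
      (show (1 : ℝ) ∈ Set.Ici 0 by simp) zero_lt_one
    rw [h0, h1] at this
    exact_mod_cast this
  refine ⟨σ * m0, σ * m1, Or.inr ⟨σ, hσ, 0, ?_⟩, Or.inr ⟨σ, hσ, 1, ?_⟩, ?_, ?_⟩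
  · push_cast; rw [h0]
  · push_cast; rw [h1]
  · rcases hσ' with rfl | rfl <;> omega
  intro j hj hcase
  by_cases hj0 : j ∈ S₀
  · exact (hM₀ j hj0).trans (Nat.le_add_right _ _)
  rcases hj with hj | ⟨τ, hτ, n, hjn⟩
  · exact absurd hj hj0
  rw [hidx τ hτ n j hjn hj0]
  have hT := hs τ hτ
  have habs : |(j : ℝ)| ≤ 2 * s σ 1 := by
    have : |j| ≤ 2 * m1 := by
      rw [abs_le]
      rcases hσ' with rfl | rfl <;> omega
    rw [h1]
    exact_mod_cast this
  rw [IsAdmissibleSeq.abs_eq hT (hB hτ) hjn] at habs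
  have hK := Nat.le_ceil istar
  have hK1 : (1 : ℝ) ≤ (⌈istar⌉₊ : ℝ) := by linarith [hT.istar_ge]
  have h3 : s τ n ≤ s τ (2 * (⌈istar⌉₊ : ℝ)) := by
    refine habs.trans (le_trans ?_ (hT.superhomogeneous 2 _ one_le_two hK))
    refine mul_le_mul_of_nonneg_left ((hmin τ hτ).trans ?_) two_pos.le
    exact hT.strictMono.monotoneOn (show (0 : ℝ) ≤ 1 by simp)
      (show (0 : ℝ) ≤ (⌈istar⌉₊ : ℝ) by positivity) hK1
  have h4 : (n : ℝ) ≤ 2 * (⌈istar⌉₊ : ℝ) :=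
    (hT.strictMono.le_iff_le (show (0 : ℝ) ≤ n from Nat.cast_nonneg n)
      (show (0 : ℝ) ≤ 2 * (⌈istar⌉₊ : ℝ) by positivity)).mp h3
  have h5 : n ≤ 2 * ⌈istar⌉₊ := by exact_mod_cast h4
  omega

/-- A bound for the constants `γ` for which there are Diophantine frequencies. -/
noncomputable def gammaBound (istar : ℝ) (M₀ : ℕ) : ℝ :=
  4 * Real.exp (12 * Real.log (1 + 3 * (1 + (M₀ + 2 * ⌈istar⌉₊ : ℕ))))

/-- The vector `resonance a b` has zero mass, momentum and energy, so its divisor is at most `8/2 =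
4` in the frequency cube. Its four sites have bounded index or lie outside `S`, so its Diophantine
weight is bounded below; `12 = 3 · 4`. -/
theorem IsAdmissible.le_gammaBound {istar η γ : ℝ} {S₀ : Finset ℤ} {idx : ℤ → ℕ} {S : Set ℤ}
    {M₀ : ℕ} (h : IsAdmissible istar η S₀ idx S) (hM₀ : ∀ j ∈ S₀, idx j ≤ M₀) (hγ : 0 < γ)
    {ω : ℤ → ℝ} (hω : ω ∈ dioph γ S idx) : γ ≤ gammaBound istar M₀ := by
  obtain ⟨a, b, ha, hb, hab, hidx⟩ := h.exists_pair hM₀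
  set M : ℕ := M₀ + 2 * ⌈istar⌉₊ with hMdef
  have h1 := mem_dioph_bound hω (resonance_ne_zero hab) (normal_resonance_le ha hb)
    (momentum_resonance a b) (mass_resonance a b)
  have h2 := abs_freqDot_sub_energy_le hω.1 (resonance a b)
  rw [energy_resonance, Int.cast_zero, sub_zero] at h2
  have h3 : γ * diophWeight S idx (resonance a b) ≤ 4 := by
    linarith [lOne_resonance_le a b]
  have hsite : ∀ (j n : ℤ), |(n : ℝ)| ≤ 3 → (j = a ∨ j = b ∨ j = 2 * b - a ∨ j = 2 * a - b) →
      siteLogSum S idx (Finsupp.single j n) ≤ Real.log (1 + 3 * (1 + M)) := by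
    intro j n hn hj
    rw [siteLogSum_single]
    unfold siteLog
    split_ifs with hjS
    · refine Real.log_le_log (by positivity) ?_
      have : (idx j : ℝ) ≤ M := by exact_mod_cast hidx j hjS hj
      have h4 : max 1 (idx j : ℝ) ≤ 1 + M :=
        max_le (by linarith [Nat.cast_nonneg (α := ℝ) M]) (by linarith)
      gcongr
    · exact Real.log_nonneg (by linarith [Nat.cast_nonneg (α := ℝ) M])
  have h4 : siteLogSum S idx (resonance a b) ≤ 4 * Real.log (1 + 3 * (1 + M)) := by
    have e1 := siteLogSum_add_le (S := S) (idx := idx) (Finsupp.single a 3)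
      (Finsupp.single b (-3) +
        (Finsupp.single (2 * b - a) 1 + Finsupp.single (2 * a - b) (-1)))
    have e2 := siteLogSum_add_le (S := S) (idx := idx) (Finsupp.single b (-3))
      (Finsupp.single (2 * b - a) 1 + Finsupp.single (2 * a - b) (-1))
    have e3 := siteLogSum_add_le (S := S) (idx := idx) (Finsupp.single (2 * b - a) 1)
      (Finsupp.single (2 * a - b) (-1))
    have s1 := hsite a 3 (by norm_num) (by tauto)
    have s2 := hsite b (-3) (by norm_num) (by tauto)
    have s3 := hsite (2 * b - a) 1 (by norm_num) (by tauto)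
    have s4 := hsite (2 * a - b) (-1) (by norm_num) (by tauto)
    unfold resonance
    linarith
  have h5 := exp_neg_siteLogSum_le_diophWeight (S := S) (idx := idx) (resonance a b)
  have h6 : γ * Real.exp (-(12 * Real.log (1 + 3 * (1 + M)))) ≤ 4 := by
    refine le_trans (mul_le_mul_of_nonneg_left ?_ hγ.le) h3
    exact (Real.exp_le_exp.mpr (by linarith)).trans h5
  rw [Real.exp_neg, ← div_eq_mul_inv, div_le_iff₀ (Real.exp_pos _)] at h6
  exact h6

/-! ### The constant -/

theorem one_le_inv_rpow {η δ : ℝ} (hη : 1 < η) (hδ : 0 < δ) (hδ1 : δ < 1) :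
    1 ≤ 1 / δ ^ (1 / η) := by
  rw [le_div_iff₀ (by positivity), one_mul]
  exact Real.rpow_le_one hδ.le hδ1.le (by positivity)

/-- With `t = δ^{-1/η}` one has `1/δ = t^η ≤ t² ≤ exp (2t)`; this is where `η ≤ 2` enters. -/
theorem inv_le_exp {η δ : ℝ} (hη : 1 < η) (hη2 : η ≤ 2) (hδ : 0 < δ) (hδ1 : δ < 1) :
    1 / δ ≤ Real.exp (2 * (1 / δ ^ (1 / η))) := by
  set t := 1 / δ ^ (1 / η) with ht
  have ht1 : 1 ≤ t := one_le_inv_rpow hη hδ hδ1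
  have h1 : 1 / δ = t ^ η := by
    rw [ht, Real.div_rpow zero_le_one (by positivity), Real.one_rpow, ← Real.rpow_mul hδ.le,
      one_div_mul_cancel (by positivity), Real.rpow_one]
  rw [h1]
  calc t ^ η ≤ t ^ (2 : ℝ) := Real.rpow_le_rpow_of_exponent_le ht1 hη2
    _ ≤ (Real.exp t) ^ (2 : ℝ) :=
        Real.rpow_le_rpow (by linarith) (by linarith [Real.add_one_le_exp t]) (by norm_num)
    _ = Real.exp (2 * t) := by rw [← Real.exp_mul, mul_comm]

theorem cutoff_le {istar η δ : ℝ} (histar : 21 ≤ istar) (hη : 1 < η) (hδ : 0 < δ) (hδ1 : δ < 1) :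
    (cutoff istar η δ : ℝ) ≤ (istar + 2) * Real.exp (1152 * (1 / δ ^ (1 / η))) := by
  have ht1 := one_le_inv_rpow hη hδ hδ1
  have h1 : (1152 / δ) ^ (1 / η) ≤ 1152 * (1 / δ ^ (1 / η)) := by
    rw [Real.div_rpow (by norm_num) hδ.le, ← mul_one_div]
    refine mul_le_mul_of_nonneg_right ?_ (by linarith)
    calc (1152 : ℝ) ^ (1 / η) ≤ 1152 ^ (1 : ℝ) :=
          Real.rpow_le_rpow_of_exponent_le (by norm_num) (by rw [div_le_one (by linarith)]; exact hη.le)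
      _ = 1152 := Real.rpow_one _
  have h2 := Real.exp_le_exp.mpr h1
  have h3 : (1 : ℝ) ≤ Real.exp (1152 * (1 / δ ^ (1 / η))) := Real.one_le_exp (by linarith)
  have h4 := Nat.ceil_lt_add_one (show 0 ≤ max istar (Real.exp ((1152 / δ) ^ (1 / η))) from
    le_max_of_le_left (by linarith))
  have h5 : max istar (Real.exp ((1152 / δ) ^ (1 / η))) ≤
      (istar + 1) * Real.exp (1152 * (1 / δ ^ (1 / η))) := max_le (by nlinarith) (by nlinarith)
  unfold cutoff
  linarith

/-- All the losses are bounded by a simple exponential. -/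
theorem exists_constant (istar : ℝ) (histar : 21 ≤ istar) (N₀ M₀ : ℕ) (D : ℝ) (hD : 0 ≤ D) :
    ∃ c : ℝ, 0 < c ∧ ∀ η δ : ℝ, 1 < η → η ≤ 2 → 0 < δ → δ < 1 →
      D + 16 / δ + (N₀ + 2 * cutoff istar η δ + 2) * siteLoss istar M₀ η δ ≤
        Real.exp (c / δ ^ (1 / η)) := by
  set X : ℝ := istar + 2
  set D' : ℝ := D + 16 + (N₀ + 2 * X + 2) * (10000 * (1 + M₀ + X)) with hD'
  have hX : 0 ≤ X := by linarith
  -- `2306 = 2 · 1152 + 2`: the cutoff enters twice, as number of sites and as bound for their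
  -- indices, and `1/δ` costs `exp (2t)`. The prefactor `D'` is absorbed since `t ≥ 1`.
  refine ⟨D' + 2306, by positivity, fun η δ hη hη2 hδ hδ1 => ?_⟩
  have ht1 := one_le_inv_rpow hη hδ hδ1
  have h1 := inv_le_exp hη hη2 hδ hδ1
  have h2 := cutoff_le histar hη hδ hδ1
  set t := 1 / δ ^ (1 / η) with ht
  set e := Real.exp (1152 * t) with he
  set N : ℝ := (cutoff istar η δ : ℝ)
  set v := 1 / δ with hv
  have he1 : 1 ≤ e := Real.one_le_exp (by linarith)
  have hv1 : 1 ≤ v := by rw [hv, le_div_iff₀ hδ]; linarith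
  have hN : 0 ≤ N := Nat.cast_nonneg _
  have h3 : (N₀ + 2 * N + 2 : ℝ) ≤ (N₀ + 2 * X + 2) * e := by
    have : (0 : ℝ) ≤ N₀ := Nat.cast_nonneg _
    nlinarith [mul_nonneg this (sub_nonneg.mpr he1)]
  have h4 : siteLoss istar M₀ η δ ≤ 10000 * (1 + M₀ + X) * e * v := by
    have : siteLoss istar M₀ η δ = 10000 * (1 + M₀ + N) * v := by
      simp only [siteLoss, hv]; ring
    rw [this]
    have h0 : (0 : ℝ) ≤ M₀ := Nat.cast_nonneg _
    refine mul_le_mul_of_nonneg_right ?_ (by linarith)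
    nlinarith [mul_nonneg h0 (sub_nonneg.mpr he1)]
  have h5 : (N₀ + 2 * N + 2) * siteLoss istar M₀ η δ ≤
      (N₀ + 2 * X + 2) * e * (10000 * (1 + M₀ + X) * e * v) :=
    mul_le_mul h3 h4 (siteLoss_nonneg _ _ _ hδ) (by positivity)
  have hw : 1 ≤ e * e * v := by
    have : 1 ≤ e * e := by nlinarith
    nlinarith
  have hwv : v ≤ e * e * v := by
    have : 1 ≤ e * e := by nlinarith
    nlinarith
  have h6 : D + 16 / δ + (N₀ + 2 * N + 2) * siteLoss istar M₀ η δ ≤ D' * (e * e * v) := by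
    have : 16 / δ = 16 * v := by rw [hv]; ring
    rw [this, hD']
    nlinarith [mul_le_mul_of_nonneg_left hw hD]
  refine h6.trans ?_
  have h7 : e * e * v ≤ Real.exp (2306 * t) := by
    calc e * e * v ≤ e * e * Real.exp (2 * t) := mul_le_mul_of_nonneg_left h1 (by positivity)
      _ = Real.exp (2306 * t) := by rw [he, ← Real.exp_add, ← Real.exp_add]; ring_nf
  have h8 : D' ≤ Real.exp (D' * t) := by
    have hD'0 : 0 ≤ D' := by positivity
    have := Real.add_one_le_exp (D' * t)
    nlinarith
  calc D' * (e * e * v) ≤ Real.exp (D' * t) * Real.exp (2306 * t) :=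
        mul_le_mul h8 h7 (by positivity) (Real.exp_pos _).le
    _ = Real.exp ((D' + 2306) / δ ^ (1 / η)) := by
        rw [← Real.exp_add, ht]; ring_nf

/-! ### Comparison of majorant norms -/

/-- `∏_j w_j ^ α_j` for a real sequence `w`. -/
noncomputable def realPow (w : ℤ → ℝ) (α : MIdx) : ℝ := α.prod fun j n => w j ^ n

theorem realPow_nonneg {w : ℤ → ℝ} (hw : ∀ j, 0 ≤ w j) (α : MIdx) : 0 ≤ realPow w α :=
  Finset.prod_nonneg fun j _ => pow_nonneg (hw j) _

theorem norm_midxPow (u : ℤ → ℂ) (α : MIdx) : ‖midxPow u α‖ = realPow (fun j => ‖u j‖) α := by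
  simp [midxPow, realPow, Finsupp.prod, norm_prod]

theorem midxPow_ofReal (w : ℤ → ℝ) (α : MIdx) :
    midxPow (fun j => (w j : ℂ)) α = (realPow w α : ℂ) := by
  simp [midxPow, realPow, Finsupp.prod]

theorem realPow_mul_rpow (w : ℤ → ℝ) (δ : ℝ) (α : MIdx) :
    realPow (fun j => w j * jj j ^ δ) α = realPow w α * Real.exp (δ * logWeight α) := by
  unfold realPow logWeight Finsupp.prod Finsupp.sum
  rw [Finset.mul_sum, Real.exp_sum, ← Finset.prod_mul_distrib]
  refine Finset.prod_congr rfl fun j _ => ?_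
  dsimp only
  rw [mul_pow, Real.rpow_def_of_pos (jj_pos j), ← Real.exp_nat_mul]
  ring_nf

theorem norm_majorantTerm (h : FormalHam) (u : ℤ → ℂ) (j : ℤ) (q : MIdx × MIdx) :
    ‖majorantTerm h u j q‖ = ‖h q.1 q.2‖ * (q.2 j : ℝ) * realPow (fun i => ‖u i‖) q.1 *
      realPow (fun i => ‖u i‖) (q.2 - Finsupp.single j 1) := by
  simp [majorantTerm, norm_midxPow]

/-- At a nonnegative sequence there is no cancellation, so the size of the field is the sum of the
moduli of its terms. -/
theorem majorantTerm_ofReal (g : FormalHam) {w : ℤ → ℝ} (hw : ∀ i, 0 ≤ w i) (j : ℤ)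
    (q : MIdx × MIdx) :
    majorantTerm g (fun i => (w i : ℂ)) j q = (‖majorantTerm g (fun i => (w i : ℂ)) j q‖ : ℂ) := by
  rw [norm_majorantTerm]
  simp only [Complex.norm_real, Real.norm_of_nonneg (hw _)]
  simp [majorantTerm, midxPow_ofReal]

theorem logWeight_tsub_single {β : MIdx} {j : ℤ} (h : β j ≠ 0) :
    logWeight (β - Finsupp.single j 1) = logWeight β - Real.log (jj j) := by
  have := congrArg logWeight (single_add_tsub h)
  rw [logWeight_add, logWeight_single] at this
  linarith

/-- Passing from `|u_i|` to `|u_i| ⌊i⌋^δ` multiplies the monomial `u^α ū^{β - e_j}` by `exp (δ (W -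
log ⌊j⌋))`. The second `log ⌊j⌋` is kept as the factor `⌊j⌋^{-δ}`, which the output weight of index
`p + δ` uses up. -/
theorem norm_majorantTerm_le {h g : FormalHam} {C δ : ℝ} (u : ℤ → ℂ) (j : ℤ) (q : MIdx × MIdx)
    (hle : q.2 j ≠ 0 → ‖h q.1 q.2‖ ≤
      C * Real.exp (δ * (logWeight (q.1 + q.2) - 2 * Real.log (jj j))) * ‖g q.1 q.2‖) :
    ‖majorantTerm h u j q‖ ≤ C * Real.exp (-(δ * Real.log (jj j))) *
      ‖majorantTerm g (fun i => ((‖u i‖ * jj i ^ δ : ℝ) : ℂ)) j q‖ := by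
  have hw : ∀ i, 0 ≤ ‖u i‖ * jj i ^ δ := fun i =>
    mul_nonneg (norm_nonneg _) (Real.rpow_nonneg (jj_pos i).le _)
  rw [norm_majorantTerm, norm_majorantTerm]
  simp only [Complex.norm_real, Real.norm_of_nonneg (hw _)]
  by_cases hj : q.2 j = 0
  · simp [hj]
  rw [realPow_mul_rpow, realPow_mul_rpow, logWeight_tsub_single hj]
  set x := realPow (fun i => ‖u i‖) q.1 with hx
  set y := realPow (fun i => ‖u i‖) (q.2 - Finsupp.single j 1) with hy
  have hx0 : 0 ≤ x := realPow_nonneg (fun _ => norm_nonneg _) _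
  have hy0 : 0 ≤ y := realPow_nonneg (fun _ => norm_nonneg _) _
  have h1 : Real.exp (δ * (logWeight (q.1 + q.2) - 2 * Real.log (jj j))) =
      Real.exp (-(δ * Real.log (jj j))) * Real.exp (δ * logWeight q.1) *
        Real.exp (δ * (logWeight q.2 - Real.log (jj j))) := by
    rw [logWeight_add, ← Real.exp_add, ← Real.exp_add]
    ring_nf
  have h2 := hle hj
  rw [h1] at h2
  calc ‖h q.1 q.2‖ * (q.2 j : ℝ) * x * y = ‖h q.1 q.2‖ * ((q.2 j : ℝ) * x * y) := by ring
    _ ≤ _ := mul_le_mul_of_nonneg_right h2 (by positivity)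
    _ = _ := by ring

theorem fieldSize_le {h g : FormalHam} {C δ : ℝ} (hC : 0 ≤ C) (u : ℤ → ℂ) (j : ℤ)
    (hle : ∀ q : MIdx × MIdx, q.2 j ≠ 0 → ‖h q.1 q.2‖ ≤
      C * Real.exp (δ * (logWeight (q.1 + q.2) - 2 * Real.log (jj j))) * ‖g q.1 q.2‖)
    (hg : fieldSize g (fun i => ((‖u i‖ * jj i ^ δ : ℝ) : ℂ)) j < ∞) :
    fieldSize h u j ≤ ENNReal.ofReal (C * Real.exp (-(δ * Real.log (jj j)))) *
      fieldSize g (fun i => ((‖u i‖ * jj i ^ δ : ℝ) : ℂ)) j := by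
  set w : ℤ → ℂ := fun i => ((‖u i‖ * jj i ^ δ : ℝ) : ℂ) with hw
  have hw0 : ∀ i, 0 ≤ ‖u i‖ * jj i ^ δ := fun i =>
    mul_nonneg (norm_nonneg _) (Real.rpow_nonneg (jj_pos i).le _)
  have hsg : Summable (majorantTerm g w j) := by
    by_contra hs
    rw [fieldSize, if_neg hs] at hg
    exact lt_irrefl _ hg
  have hsn : Summable fun q => ‖majorantTerm g w j q‖ := hsg.norm
  set K := C * Real.exp (-(δ * Real.log (jj j))) with hK
  have hK0 : 0 ≤ K := by positivity
  have hle' : ∀ q, ‖majorantTerm h u j q‖ ≤ K * ‖majorantTerm g w j q‖ := fun q =>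
    norm_majorantTerm_le u j q (hle q)
  have hsh : Summable fun q => ‖majorantTerm h u j q‖ :=
    Summable.of_nonneg_of_le (fun _ => norm_nonneg _) hle' (hsn.mul_left K)
  have hg_eq : ‖∑' q, majorantTerm g w j q‖ = ∑' q, ‖majorantTerm g w j q‖ := by
    have h1 : ∑' q, majorantTerm g w j q = ((∑' q, ‖majorantTerm g w j q‖ : ℝ) : ℂ) := by
      rw [Complex.ofReal_tsum]
      exact tsum_congr fun q => majorantTerm_ofReal g hw0 j q
    rw [h1, Complex.norm_real, Real.norm_of_nonneg (tsum_nonneg fun _ => norm_nonneg _)]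
  rw [fieldSize, fieldSize, if_pos hsh.of_norm, if_pos hsg, ← ofReal_norm,
    ← ofReal_norm, ← ENNReal.ofReal_mul hK0]
  refine ENNReal.ofReal_le_ofReal ?_
  rw [norm_mul, norm_mul, Complex.norm_I, one_mul, one_mul, hg_eq, ← tsum_mul_left]
  exact (norm_tsum_le_tsum_norm hsh).trans (hsh.tsum_le_tsum hle' (hsn.mul_left K))

/-- The sequence `|u_j| (max {2, |j|}) ^ δ`. -/
noncomputable def WSpace.shift {p δ : ℝ} (u : WSpace ℂ (p + δ)) : WSpace ℂ p :=
  ⟨fun i => ((‖u.entry i‖ * jj i ^ δ : ℝ) : ℂ), by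
    refine ⟨u.supNorm, ?_⟩
    rintro _ ⟨i, rfl⟩
    have h := u.le_supNorm i
    dsimp only
    rw [Complex.norm_real, Real.norm_of_nonneg
      (mul_nonneg (norm_nonneg _) (Real.rpow_nonneg (jj_pos i).le _)), mul_assoc,
      ← Real.rpow_add (jj_pos i), add_comm δ]
    exact h⟩

theorem WSpace.norm_shift_le {p δ : ℝ} (u : WSpace ℂ (p + δ)) : ‖u.shift‖ ≤ ‖u‖ := by
  refine ciSup_le fun i => ?_
  have h := u.le_supNorm i
  have : ‖u.shift.entry i‖ = ‖u.entry i‖ * jj i ^ δ := by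
    change ‖((‖u.entry i‖ * jj i ^ δ : ℝ) : ℂ)‖ = _
    rw [Complex.norm_real, Real.norm_of_nonneg
      (mul_nonneg (norm_nonneg _) (Real.rpow_nonneg (jj_pos i).le _))]
  rw [this, mul_assoc, ← Real.rpow_add (jj_pos i), add_comm δ]
  exact h

/-- The shift `|u_i| ⌊i⌋^δ` maps the ball of `w_{p+δ}` into that of `w_p`, so the field of `h` is
compared with the field of `g` at the shifted point. -/
theorem hamNorm_le_of_norm_le {r p δ C : ℝ} (hC : 0 ≤ C) {h g : FormalHam}
    (hle : ∀ α β j, β j ≠ 0 → ‖h α β‖ ≤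
      C * Real.exp (δ * (logWeight (α + β) - 2 * Real.log (jj j))) * ‖g α β‖)
    (hg : hamNorm r p g < ∞) :
    hamNorm r (p + δ) h ≤ ENNReal.ofReal C * hamNorm r p g := by
  unfold hamNorm at hg ⊢
  set T := ⨆ (u : WSpace ℂ p) (_ : ‖u‖ ≤ r) (j : ℤ),
    fieldSize g u.entry j * ENNReal.ofReal (jj j ^ p) with hT
  have hTfin : T < ∞ := by
    have h1 : (ENNReal.ofReal r)⁻¹ ≠ 0 := ENNReal.inv_ne_zero.mpr ENNReal.ofReal_ne_top
    exact ENNReal.lt_top_of_mul_ne_top_right hg.ne h1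
  rw [mul_left_comm]
  refine mul_le_mul_right ?_ _
  refine iSup₂_le fun u hu => iSup_le fun j => ?_
  have hT' : fieldSize g u.shift.entry j * ENNReal.ofReal (jj j ^ p) ≤ T :=
    le_iSup₂_of_le u.shift ((WSpace.norm_shift_le u).trans hu)
      (le_iSup (fun j => fieldSize g u.shift.entry j * ENNReal.ofReal (jj j ^ p)) j)
  have hfin : fieldSize g u.shift.entry j < ∞ := by
    refine ENNReal.lt_top_of_mul_ne_top_left (hT'.trans_lt hTfin).ne ?_
    exact (ENNReal.ofReal_pos.mpr (Real.rpow_pos_of_pos (jj_pos j) p)).ne'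
  have h1 : fieldSize h u.entry j ≤ ENNReal.ofReal (C * Real.exp (-(δ * Real.log (jj j)))) *
      fieldSize g u.shift.entry j :=
    fieldSize_le hC u.entry j (fun q => hle q.1 q.2 j) hfin
  have h2 : ENNReal.ofReal (C * Real.exp (-(δ * Real.log (jj j)))) *
      ENNReal.ofReal (jj j ^ (p + δ)) = ENNReal.ofReal C * ENNReal.ofReal (jj j ^ p) := by
    rw [← ENNReal.ofReal_mul (by positivity), ← ENNReal.ofReal_mul hC, Real.rpow_add (jj_pos j),
      Real.rpow_def_of_pos (jj_pos j) δ, mul_comm (Real.log _) δ, Real.exp_neg]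
    congr 1
    field_simp
  calc fieldSize h u.entry j * ENNReal.ofReal (jj j ^ (p + δ))
      ≤ (ENNReal.ofReal (C * Real.exp (-(δ * Real.log (jj j)))) *
        fieldSize g u.shift.entry j) * ENNReal.ofReal (jj j ^ (p + δ)) := by gcongr
    _ = ENNReal.ofReal C * (fieldSize g u.shift.entry j * ENNReal.ofReal (jj j ^ p)) := by
        rw [mul_right_comm, h2]; ring
    _ ≤ ENNReal.ofReal C * T := by gcongr

/-! ### Multiplication by functions of the frequency -/

section Multiplication

variable {E : Type} {O : Set (ℤ → ℝ)} {A : Set E} {γ : ℝ} {x y : ℝ≥0∞} {c : O → ℂ}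

theorem enorm_le_lipNorm (f : O → A → ℂ) (ω : O) (I : A) : ‖f ω I‖ₑ ≤ lipNorm γ f :=
  (le_iSup₂ (f := fun (ω : O) (I : A) => ‖f ω I‖ₑ) ω I).trans le_self_add

theorem lipNorm_mul_le (hx : ∀ ω, ‖c ω‖ₑ ≤ x)
    (hy : ∀ ω ω', ‖c ω - c ω'‖ₑ ≤ y * freqDist ω.1 ω'.1) (f : O → A → ℂ) :
    lipNorm γ (fun ω I => c ω * f ω I) ≤ (x + ENNReal.ofReal γ * y) * lipNorm γ f := by
  unfold lipNorm
  set s := ⨆ (ω : O) (I : A), ‖f ω I‖ₑ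
  set t := ⨆ (ω : O) (ω' : O) (_ : ω ≠ ω') (I : A), ‖f ω I - f ω' I‖ₑ / freqDist ω.1 ω'.1
  have hs : ∀ ω I, ‖f ω I‖ₑ ≤ s := fun ω I =>
    le_iSup₂ (f := fun (ω : O) (I : A) => ‖f ω I‖ₑ) ω I
  have h1 : (⨆ (ω : O) (I : A), ‖c ω * f ω I‖ₑ) ≤ x * s := by
    refine iSup₂_le fun ω I => ?_
    rw [enorm_mul]
    exact mul_le_mul' (hx ω) (hs ω I)
  have h2 : (⨆ (ω : O) (ω' : O) (_ : ω ≠ ω') (I : A),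
      ‖c ω * f ω I - c ω' * f ω' I‖ₑ / freqDist ω.1 ω'.1) ≤ x * t + y * s := by
    refine iSup₂_le fun ω ω' => iSup₂_le fun hne I => ?_
    have ht : ‖f ω I - f ω' I‖ₑ / freqDist ω.1 ω'.1 ≤ t :=
      le_iSup₂_of_le ω ω' (le_iSup₂_of_le hne I le_rfl)
    have heq : c ω * f ω I - c ω' * f ω' I =
        c ω * (f ω I - f ω' I) + (c ω - c ω') * f ω' I := by ring
    have h3 : ‖c ω * f ω I - c ω' * f ω' I‖ₑ ≤
        x * ‖f ω I - f ω' I‖ₑ + y * freqDist ω.1 ω'.1 * s := by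
      rw [heq]
      refine (enorm_add_le _ _).trans ?_
      rw [enorm_mul, enorm_mul]
      exact add_le_add (mul_le_mul' (hx ω) le_rfl) (mul_le_mul' (hy ω ω') (hs ω' I))
    refine (ENNReal.div_le_div_right h3 _).trans ?_
    rw [ENNReal.add_div, mul_div_assoc]
    refine add_le_add (mul_le_mul' le_rfl ht) ?_
    -- The quotient of the distance by itself is at most 1 even if the distance is `0` or `∞`.
    rw [mul_right_comm, mul_div_assoc]
    exact mul_le_of_le_one_right' ENNReal.div_self_le_one
  calc _ ≤ x * s + ENNReal.ofReal γ * (x * t + y * s) :=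
        add_le_add h1 (mul_le_mul' le_rfl h2)
    -- Adding the cross term of the two Lipschitz parts completes the product.
    _ ≤ x * s + ENNReal.ofReal γ * (x * t + y * s) +
        ENNReal.ofReal γ * y * (ENNReal.ofReal γ * t) := le_self_add
    _ = _ := by ring

variable {𝕜 : Type} [NontriviallyNormedField 𝕜] [NormedAlgebra 𝕜 ℂ] [NormedAddCommGroup E]
  [NormedSpace 𝕜 E]

theorem IsCLip.mul (hc : Continuous c) (hxt : x ≠ ∞) (hyt : y ≠ ∞) (hx : ∀ ω, ‖c ω‖ₑ ≤ x)
    (hy : ∀ ω ω', ‖c ω - c ω'‖ₑ ≤ y * freqDist ω.1 ω'.1) {f : O → A → ℂ} (hf : IsCLip 𝕜 γ f) :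
    IsCLip 𝕜 γ fun ω I => c ω * f ω I where
  finite := (lipNorm_mul_le hx hy f).trans_lt (ENNReal.mul_lt_top
    (ENNReal.add_lt_top.mpr ⟨hxt.lt_top, ENNReal.mul_lt_top ENNReal.ofReal_lt_top hyt.lt_top⟩)
    hf.finite)
  continuous I := hc.mul (hf.continuous I)
  analytic ω := by
    obtain ⟨F, hF, hFI⟩ := hf.analytic ω
    exact ⟨fun I => c ω * F I, analyticOn_const.mul hF, fun I => by rw [hFI]⟩

theorem IsLimFinDep.mul (hc : Continuous c)
    (hk : ∃ k : ℕ, ∀ ω ω' : O, (∀ j : ℤ, |j| ≤ k → ω.1 j = ω'.1 j) → c ω = c ω')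
    (hxt : x ≠ ∞) (hyt : y ≠ ∞) (hx : ∀ ω, ‖c ω‖ₑ ≤ x)
    (hy : ∀ ω ω', ‖c ω - c ω'‖ₑ ≤ y * freqDist ω.1 ω'.1) {f : O → A → ℂ}
    (hf : IsLimFinDep 𝕜 γ f) : IsLimFinDep 𝕜 γ fun ω I => c ω * f ω I := by
  refine ⟨hf.1.mul hc hxt hyt hx hy, fun ε hε => ?_⟩
  have hKt : x + ENNReal.ofReal γ * y ≠ ∞ :=
    ENNReal.add_ne_top.mpr ⟨hxt, ENNReal.mul_ne_top ENNReal.ofReal_ne_top hyt⟩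
  set K := (x + ENNReal.ofReal γ * y).toReal with hK
  have hK0 : 0 ≤ K := ENNReal.toReal_nonneg
  -- `K + 1` instead of `K`, which may vanish.
  obtain ⟨g, ⟨hg, k, hgk⟩, hfg⟩ := hf.2 (ε / (K + 1)) (by positivity)
  obtain ⟨k', hk'⟩ := hk
  refine ⟨fun ω I => c ω * g ω I, ⟨hg.mul hc hxt hyt hx hy, max k k', fun ω ω' h => ?_⟩, ?_⟩
  · have h1 := hgk ω ω' fun j hj => h j (hj.trans (by exact_mod_cast le_max_left k k'))
    have h2 := hk' ω ω' fun j hj => h j (hj.trans (by exact_mod_cast le_max_right k k'))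
    dsimp only
    rw [h1, h2]
  · have heq : ((fun ω I => c ω * f ω I) - fun ω I => c ω * g ω I) =
        fun (ω : O) (I : A) => c ω * (f - g) ω I := by
      funext ω I
      simp only [Pi.sub_apply]
      ring
    rw [heq]
    refine (lipNorm_mul_le hx hy _).trans ((mul_le_mul' le_rfl hfg).trans ?_)
    rw [← ENNReal.ofReal_toReal hKt, ← hK, ← ENNReal.ofReal_mul hK0]
    refine ENNReal.ofReal_le_ofReal ?_
    rw [mul_div_assoc', div_le_iff₀ (by positivity)]
    nlinarith

end Multiplication

/-! ### The small divisors as functions of the frequency -/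

theorem enorm_freqDot_sub_le (ω ω' : ℤ → ℝ) (l : ℤ →₀ ℤ) :
    ‖freqDot ω l - freqDot ω' l‖ₑ ≤ ENNReal.ofReal (lOne l) * freqDist ω ω' := by
  have heq : freqDot ω l - freqDot ω' l = ∑ j ∈ l.support, (ω j - ω' j) * (l j : ℝ) := by
    simp only [freqDot, Finsupp.sum]
    rw [← Finset.sum_sub_distrib]
    exact Finset.sum_congr rfl fun _ _ => by ring
  rw [heq, lOne, Finsupp.sum, ENNReal.ofReal_sum_of_nonneg fun _ _ => abs_nonneg _,
    Finset.sum_mul]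
  refine (enorm_sum_le _ _).trans (Finset.sum_le_sum fun j _ => ?_)
  rw [enorm_mul, mul_comm, ← Real.norm_eq_abs, ofReal_norm]
  exact mul_le_mul' le_rfl (le_iSup (fun j => ‖ω j - ω' j‖ₑ) j)

section Divisor

variable {O : Set (ℤ → ℝ)} {l : ℤ →₀ ℤ} {m : ℝ}

/-- The factor `-i / (ω · ℓ)`. -/
noncomputable def divisorInv (O : Set (ℤ → ℝ)) (l : ℤ →₀ ℤ) (ω : O) : ℂ :=
  -Complex.I / (freqDot ω.1 l : ℂ)

theorem norm_divisorInv (ω : O) : ‖divisorInv O l ω‖ = 1 / |freqDot ω.1 l| := by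
  simp [divisorInv]

theorem enorm_divisorInv_le (hm : 0 < m) (hO : ∀ ω ∈ O, m ≤ |freqDot ω l|) (ω : O) :
    ‖divisorInv O l ω‖ₑ ≤ ENNReal.ofReal (1 / m) := by
  rw [← ofReal_norm, norm_divisorInv]
  exact ENNReal.ofReal_le_ofReal (one_div_le_one_div_of_le hm (hO ω.1 ω.2))

theorem enorm_divisorInv_sub_le (hm : 0 < m) (hO : ∀ ω ∈ O, m ≤ |freqDot ω l|) (ω ω' : O) :
    ‖divisorInv O l ω - divisorInv O l ω'‖ₑ ≤
      ENNReal.ofReal (lOne l / m ^ 2) * freqDist ω.1 ω'.1 := by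
  have h1 := hO ω.1 ω.2
  have h2 := hO ω'.1 ω'.2
  have h1' : (freqDot ω.1 l : ℂ) ≠ 0 := by
    exact_mod_cast abs_pos.mp (hm.trans_le h1)
  have h2' : (freqDot ω'.1 l : ℂ) ≠ 0 := by
    exact_mod_cast abs_pos.mp (hm.trans_le h2)
  have heq : divisorInv O l ω - divisorInv O l ω' =
      divisorInv O l ω * divisorInv O l ω' * (-Complex.I) *
        ((freqDot ω.1 l - freqDot ω'.1 l : ℝ) : ℂ) := by
    unfold divisorInv
    push_cast
    field_simp
    linear_combination (-(freqDot ω'.1 l : ℂ) + (freqDot ω.1 l : ℂ)) * Complex.I_sq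
  have h3 : ENNReal.ofReal (lOne l / m ^ 2) =
      ENNReal.ofReal (1 / m) * ENNReal.ofReal (1 / m) * ENNReal.ofReal (lOne l) := by
    rw [← ENNReal.ofReal_mul (by positivity), ← ENNReal.ofReal_mul (by positivity)]
    congr 1
    field_simp
  have h4 : ‖((freqDot ω.1 l - freqDot ω'.1 l : ℝ) : ℂ)‖ₑ =
      ‖freqDot ω.1 l - freqDot ω'.1 l‖ₑ := by
    rw [← ofReal_norm, Complex.norm_real, ofReal_norm]
  have h5 : ‖-Complex.I‖ₑ = 1 := by
    rw [← ofReal_norm, norm_neg, Complex.norm_I, ENNReal.ofReal_one]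
  rw [heq, enorm_mul, enorm_mul, enorm_mul, h4, h5, mul_one, h3, mul_assoc _ (ENNReal.ofReal _)]
  exact mul_le_mul' (mul_le_mul' (enorm_divisorInv_le hm hO ω) (enorm_divisorInv_le hm hO ω'))
    (enorm_freqDot_sub_le _ _ _)

theorem continuous_divisorInv (hm : 0 < m) (hO : ∀ ω ∈ O, m ≤ |freqDot ω l|) :
    Continuous (divisorInv O l) := by
  unfold divisorInv
  refine continuous_const.div (Complex.continuous_ofReal.comp ?_) fun ω => ?_
  · unfold freqDot Finsupp.sum
    exact continuous_finsetSum _ fun j _ =>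
      ((continuous_apply j).comp continuous_subtype_val).mul continuous_const
  · exact_mod_cast abs_pos.mp (hm.trans_le (hO ω.1 ω.2))

theorem divisorInv_finDep (O : Set (ℤ → ℝ)) (l : ℤ →₀ ℤ) : ∃ k : ℕ, ∀ ω ω' : O,
    (∀ j : ℤ, |j| ≤ k → ω.1 j = ω'.1 j) → divisorInv O l ω = divisorInv O l ω' := by
  refine ⟨l.support.sup Int.natAbs, fun ω ω' h => ?_⟩
  have : freqDot ω.1 l = freqDot ω'.1 l := by
    unfold freqDot
    refine Finset.sum_congr rfl fun j hj => ?_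
    have h1 : j.natAbs ≤ l.support.sup Int.natAbs := Finset.le_sup (f := Int.natAbs) hj
    dsimp only
    rw [h j (by rw [Int.abs_eq_natAbs]; exact_mod_cast h1)]
  rw [divisorInv, divisorInv, this]

end Divisor

/-! ### The monomials of the Hamiltonians of degree at most zero -/

theorem normal_midxDiff_le (S : Set ℤ) (α β : MIdx) :
    ((midxDiff α β).sum fun j n => open Classical in if j ∈ S then 0 else |n|) ≤
      normalDeg S α β := by
  classical
  have h1 : (normalDeg S α β : ℝ) = (α + β).sum fun j n => if j ∈ S then 0 else (n : ℝ) := by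
    unfold normalDeg midxSize Finsupp.sum
    rw [Finsupp.support_filter, Finset.sum_filter, Nat.cast_sum]
    refine Finset.sum_congr rfl fun j _ => ?_
    by_cases hj : j ∈ S <;> simp [hj]
  have h2 : (((midxDiff α β).sum fun j n => if j ∈ S then 0 else |n| : ℤ) : ℝ) =
      (midxDiff α β).sum fun j n => if j ∈ S then 0 else |(n : ℝ)| := by
    unfold Finsupp.sum
    push_cast
    rfl
  have h3 : (((midxDiff α β).sum fun j n => if j ∈ S then 0 else |n| : ℤ) : ℝ) ≤
      normalDeg S α β := by
    rw [h1, h2]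
    refine midxDiff_sum_le (fun s n => by split_ifs <;> simp) fun s n m h => ?_
    split_ifs
    · rfl
    · exact abs_cast_le_cast h
  convert (show _ ≤ (normalDeg S α β : ℤ) by exact_mod_cast h3)

theorem mass_midxDiff (α β : MIdx) :
    ((midxDiff α β).sum fun _ n => n) = (midxSize α : ℤ) - midxSize β := by
  unfold midxDiff
  rw [Finsupp.sum_sub_index (by simp), Finsupp.sum_mapRange_index (by simp),
    Finsupp.sum_mapRange_index (by simp)]
  simp [midxSize, Finsupp.sum]

theorem midxDiff_ne_zero {α β : MIdx} (h : α ≠ β) : midxDiff α β ≠ 0 := by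
  contrapose! h
  ext s
  have := DFunLike.congr_fun h s
  rw [midxDiff_apply, Finsupp.coe_zero, Pi.zero_apply] at this
  omega

theorem midxDiff_swap (α β : MIdx) : midxDiff α β = -midxDiff β α := by
  unfold midxDiff
  abel

theorem midxDiff_add_right (α β x : MIdx) : midxDiff (α + x) (β + x) = midxDiff α β := by
  ext s
  simp only [midxDiff_apply, Finsupp.add_apply]
  push_cast
  ring

theorem freqDot_neg (ω : ℤ → ℝ) (l : ℤ →₀ ℤ) : freqDot ω (-l) = -freqDot ω l := by
  simp [freqDot, Finsupp.sum]

theorem two_le_midxSize_add {α β : MIdx} (h : conserves α β) (hne : α ≠ β) :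
    2 ≤ midxSize (α + β) := by
  rw [midxSize_add, h.1]
  have : midxSize β ≠ 0 := by
    intro h0
    have hz : ∀ x : MIdx, midxSize x = 0 → x = 0 := fun x hx => by
      ext s
      by_contra hs
      exact hs (Finset.sum_eq_zero_iff.mp hx s (Finsupp.mem_support_iff.mpr hs))
    exact hne ((hz α (h.1.trans h0)).trans (hz β h0).symm)
  omega

theorem projDeg_eq_zero {S : Set ℤ} {I : ℤ → ℂ} {d : ℤ} (hd : d ≤ 0) {h : FormalHam} {α β : MIdx}
    (hdeg : 2 < normalDeg S α β) : projDeg S I d h α β = 0 := by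
  unfold projDeg
  refine (tsum_congr fun q => if_neg ?_).trans tsum_zero
  rintro ⟨-, -, -, h4⟩
  omega

theorem normalDeg_le_two {S : Set ℤ} {I : ℤ → ℂ} {h : FormalHam} (hproj : projLeZero S I h = h)
    {α β : MIdx} (hne : h α β ≠ 0) : normalDeg S α β ≤ 2 := by
  by_contra! hdeg
  apply hne
  rw [← hproj]
  simp only [projLeZero, Pi.add_apply]
  rw [projDeg_eq_zero (by norm_num) hdeg, projDeg_eq_zero (by norm_num) hdeg,
    projDeg_eq_zero le_rfl hdeg]
  simp

theorem projR_eq_self_iff {h : FormalHam} : projR h = h ↔ ∀ α, h α α = 0 := by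
  constructor
  · intro hh α
    have := congrFun (congrFun hh α) α
    simpa [projR, projK] using this.symm
  · intro hh
    funext α β
    simp only [projR, projK, Pi.sub_apply]
    split_ifs with hαβ
    · rw [hαβ, hh, sub_zero]
    · rw [sub_zero]

/-- `Π^d` mixes only coefficients whose two indices are shifted by the same multi-index, so `α - β`
is constant along the sum and the multiplier factors out. -/
theorem projDeg_mul {S : Set ℤ} {I : ℤ → ℂ} {d : ℤ} {h : FormalHam} (φ : (ℤ →₀ ℤ) → ℂ)
    (α β : MIdx) : projDeg S I d (fun α β => φ (midxDiff α β) * h α β) α β =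
      φ (midxDiff α β) * projDeg S I d h α β := by
  unfold projDeg
  rw [← tsum_mul_left]
  refine tsum_congr fun q => ?_
  split_ifs
  · dsimp only
    rw [midxDiff_add_right]
    ring
  · rw [mul_zero]

theorem projLeZero_mul {S : Set ℤ} {I : ℤ → ℂ} {h : FormalHam} (φ : (ℤ →₀ ℤ) → ℂ) :
    projLeZero S I (fun α β => φ (midxDiff α β) * h α β) =
      fun α β => φ (midxDiff α β) * projLeZero S I h α β := by
  funext α β
  simp only [projLeZero, Pi.add_apply, projDeg_mul]
  ring

/-- The monomials that occur in Hamiltonians of degree at most zero and of vanishing average. -/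
structure IsRelevant (S : Set ℤ) (α β : MIdx) : Prop where
  conserves : conserves α β
  ne : α ≠ β
  normalDeg_le : normalDeg S α β ≤ 2

theorem IsRelevant.le_abs_freqDot {γ : ℝ} {S : Set ℤ} {idx : ℤ → ℕ} {α β : MIdx}
    (h : IsRelevant S α β) {ω : ℤ → ℝ} (hω : ω ∈ dioph γ S idx) :
    γ * diophWeight S idx (midxDiff α β) ≤ |freqDot ω (midxDiff α β)| :=
  mem_dioph_bound hω (midxDiff_ne_zero h.ne)
    ((normal_midxDiff_le S α β).trans (by exact_mod_cast h.normalDeg_le)) h.conserves.2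
    (by rw [mass_midxDiff, h.conserves.1, sub_self])

theorem one_le_lOne {l : ℤ →₀ ℤ} (h : l ≠ 0) : 1 ≤ lOne l := by
  obtain ⟨j, hj⟩ := Finsupp.support_nonempty_iff.mpr h
  have h1 : |(l j : ℝ)| ≤ lOne l :=
    Finset.single_le_sum (f := fun j => |(l j : ℝ)|) (fun _ _ => abs_nonneg _) hj
  refine le_trans ?_ h1
  exact_mod_cast Int.one_le_abs (Finsupp.mem_support_iff.mp hj)

/-- A lower bound for the divisors, together with the bound for the resulting multiplier, including
the gain from the decay of the sequences. -/
theorem IsAdmissible.exists_divisor_bound {istar η δ γ X : ℝ} {S₀ : Finset ℤ} {idx : ℤ → ℕ}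
    {S : Set ℤ} {N₀ M₀ : ℕ} (h : IsAdmissible istar η S₀ idx S) (hN₀ : S₀.card ≤ N₀)
    (hM₀ : ∀ j ∈ S₀, idx j ≤ M₀) (hγ : 0 < γ) (hδ : 0 < δ) (hδ1 : δ < 1)
    (hX : 3 + gammaBound istar M₀ * (2 + 4 * gammaBound istar M₀) + 16 / δ +
      (N₀ + 2 * cutoff istar η δ + 2) * siteLoss istar M₀ η δ ≤ X)
    {α β : MIdx} (hr : IsRelevant S α β) :
    ∃ m : ℝ, 0 < m ∧ (∀ ω ∈ dioph γ S idx, m ≤ |freqDot ω (midxDiff α β)|) ∧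
      ∀ j, β j ≠ 0 → 1 / m + γ * (lOne (midxDiff α β) / m ^ 2) ≤
        1 / γ * Real.exp X * Real.exp (δ * (logWeight (α + β) - 2 * Real.log (jj j))) := by
  obtain ⟨a, b, σ, σ', ρ, τ, hp⟩ := exists_largestPair (two_le_midxSize_add hr.conserves hr.ne)
  have hP : momentum (midxDiff α β) = 0 := hr.conserves.2
  have hL := one_le_lOne (midxDiff_ne_zero hr.ne)
  set l := midxDiff α β with hl
  set Γ := gammaBound istar M₀ with hΓ
  set loss := (N₀ + 2 * cutoff istar η δ + 2) * siteLoss istar M₀ η δ with hloss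
  have hΓ0 : 0 < Γ := by rw [hΓ, gammaBound]; positivity
  have hloss0 : 0 ≤ loss := mul_nonneg (by positivity) (siteLoss_nonneg _ _ _ hδ)
  have hδ16 : 0 < 16 / δ := by positivity
  have hgain : ∀ j, β j ≠ 0 → 1 / γ * Real.exp X ≤
      1 / γ * Real.exp X * Real.exp (δ * (logWeight (α + β) - 2 * Real.log (jj j))) :=
    fun j hj => le_mul_of_one_le_right (by positivity)
      (Real.one_le_exp (mul_nonneg hδ.le (hp.gain_nonneg hP hj)))
  by_cases hQ : |(energy l : ℝ)| < lOne l
  · refine ⟨γ * diophWeight S idx l, mul_pos hγ (diophWeight_pos l),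
      fun ω hω => hr.le_abs_freqDot hω, fun j hj => ?_⟩
    have h1 := exp_neg_siteLogSum_le_diophWeight (S := S) (idx := idx) l
    have h2 := h.siteLogSum_le hN₀ hM₀ hδ hδ1 hp hP hQ
    have h3 : 3 + (midxSize (ρ + τ) : ℝ) ≤ _ := three_add_midxSize_le hδ hδ1 _
    have h4 := lOne_midxDiff_le α β
    rw [hp.size_eq] at h4
    push_cast at h4
    rw [← hl] at h4
    have h5 := hp.half_le_gain hP hj
    set W := diophWeight S idx l with hW
    set s := siteLogSum S idx l with hs
    set R := logWeight (ρ + τ) with hR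
    have hR0 : 0 ≤ R := logWeight_nonneg _
    have hs0 : 0 ≤ s := siteLogSum_nonneg _
    have hWpos : 0 < W := diophWeight_pos l
    have hWinv : 1 / W ≤ Real.exp (3 * s) := by
      rw [Real.exp_neg] at h1
      rw [one_div]
      exact inv_le_of_inv_le₀ (Real.exp_pos _) h1
    have hexp : Real.exp (3 * s) ≤ Real.exp (6 * s) := Real.exp_le_exp.mpr (by linarith)
    -- The Lipschitz part contains the inverse weight squared, whence `6 = 2 · 3` in the exponent;
    -- the `γ` of the norm leaves a single `1/γ`.
    have h6 : 1 / (γ * W) + γ * (lOne l / (γ * W) ^ 2) =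
        1 / γ * (1 / W + lOne l * (1 / W * (1 / W))) := by
      field_simp
    have h7 : 1 / W * (1 / W) ≤ Real.exp (6 * s) := by
      calc 1 / W * (1 / W) ≤ Real.exp (3 * s) * Real.exp (3 * s) :=
            mul_le_mul hWinv hWinv (by positivity) (Real.exp_pos _).le
        _ = Real.exp (6 * s) := by rw [← Real.exp_add]; ring_nf
    have h8 : 1 / W + lOne l * (1 / W * (1 / W)) ≤ (1 + lOne l) * Real.exp (6 * s) := by
      nlinarith [mul_le_mul_of_nonneg_left h7 (by linarith : 0 ≤ lOne l)]
    have h9 : 1 + lOne l ≤ Real.exp (16 / δ) * Real.exp (δ / 8 * R) := by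
      have : 16 / δ ≤ Real.exp (16 / δ) := by linarith [Real.add_one_le_exp (16 / δ)]
      exact (show 1 + lOne l ≤ 3 + (midxSize (ρ + τ) : ℝ) by linarith).trans
        (h3.trans (mul_le_mul_of_nonneg_right this (Real.exp_pos _).le))
    rw [h6, mul_assoc]
    refine mul_le_mul_of_nonneg_left (h8.trans ?_) (by positivity)
    calc (1 + lOne l) * Real.exp (6 * s)
        ≤ Real.exp (16 / δ) * Real.exp (δ / 8 * R) * Real.exp (δ / 8 * R + 1 + loss) :=
          mul_le_mul h9 (Real.exp_le_exp.mpr h2) (Real.exp_pos _).le (by positivity)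
      _ = Real.exp (16 / δ + δ / 8 * R + (δ / 8 * R + 1 + loss)) := by
          rw [← Real.exp_add, ← Real.exp_add]
      _ ≤ Real.exp (X + δ * (logWeight (α + β) - 2 * Real.log (jj j))) := by
          -- The left side spends `δR/4 + 1` beside `16/δ` and the site losses; the gain provides `δ
          -- (R/2 - 2)`, and the 3 in `X` covers `1 + 2δ`.
          refine Real.exp_le_exp.mpr ?_
          have h10 := mul_le_mul_of_nonneg_left h5 hδ.le
          nlinarith [mul_nonneg hδ.le hR0, mul_nonneg hΓ0.le hΓ0.le]
      _ = _ := Real.exp_add _ _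
  -- Large energy: the divisor is at least `|ℓ|₁ / 2`, and the multiplier has norm at most `2 + 4γ`.
  -- To bound this by `exp X / γ`, a Diophantine frequency is needed to bound `γ`.
  · by_cases hne : (dioph γ S idx).Nonempty
    · obtain ⟨ω₀, hω₀⟩ := hne
      have hγΓ : γ ≤ Γ := h.le_gammaBound hM₀ hγ hω₀
      refine ⟨lOne l / 2, by linarith, fun ω hω => ?_, fun j hj => ?_⟩
      · have h1 := abs_freqDot_sub_energy_le hω.1 l
        have h2 := abs_sub_abs_le_abs_sub (energy l : ℝ) (freqDot ω l)
        rw [abs_sub_comm] at h2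
        push Not at hQ
        linarith
      · refine le_trans ?_ (hgain j hj)
        have h1 : 1 / (lOne l / 2) + γ * (lOne l / (lOne l / 2) ^ 2) = (2 + 4 * γ) / lOne l := by
          field_simp
          ring
        have h2 : (2 + 4 * γ) / lOne l ≤ 2 + 4 * γ := div_le_self (by positivity) hL
        have h3 : γ * (2 + 4 * γ) ≤ Γ * (2 + 4 * Γ) := by gcongr
        have h4 := Real.add_one_le_exp X
        rw [h1, div_mul_eq_mul_div, one_mul, le_div_iff₀ hγ]
        nlinarith
    · rw [Set.not_nonempty_iff_eq_empty] at hne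
      set Y := 1 / γ * Real.exp X with hY
      have hY0 : 0 < Y := by positivity
      -- Without frequencies any `m` is a lower bound, so it is taken large enough for the required
      -- estimate.
      set m := max 1 ((1 + γ * lOne l) / Y) with hm
      have hm1 : 1 ≤ m := le_max_left _ _
      refine ⟨m, by linarith, fun ω hω => by simp [hne] at hω, fun j hj => ?_⟩
      refine le_trans ?_ (hgain j hj)
      have h1 : (1 + γ * lOne l) / m ≤ Y := by
        rw [div_le_iff₀ (by linarith), ← div_le_iff₀' hY0]
        exact le_max_right _ _
      refine le_trans ?_ h1
      rw [add_div, ← mul_div_assoc]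
      refine add_le_add_right ?_ _
      refine div_le_div_of_nonneg_left (mul_nonneg hγ.le (by linarith)) (by linarith) ?_
      nlinarith

/-! ### The homological equation -/

theorem lieInv_apply {O : Set (ℤ → ℝ)} {E : Type} {A : Set E} (H : HamFamily O A)
    (α β : MIdx) :
    lieInv O A H α β = fun ω I => divisorInv O (midxDiff α β) ω * H α β ω I := by
  funext ω I
  simp only [lieInv, LinearMap.coe_mk, AddHom.coe_mk, divisorInv]
  ring

section Homological

variable {𝕜 : Type} [NontriviallyNormedField 𝕜] [NormedAlgebra 𝕜 ℂ] {O : Set (ℤ → ℝ)} {q : ℝ}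
  {A : Set (WSpace 𝕜 q)} {S : Set ℤ} {R : Set A} {γ r p δ K : ℝ} {H : HamFamily O A}

theorem HamLeZeroR.relevant_of_ne_zero (hH : H ∈ HamLeZeroR S R γ r p) {α β : MIdx}
    (h0 : H α β ≠ 0) : IsRelevant S α β := by
  obtain ⟨ω, hω⟩ := Function.ne_iff.mp h0
  obtain ⟨I, hI⟩ := Function.ne_iff.mp hω
  obtain ⟨hfam, hle, hproj⟩ := hH
  refine ⟨?_, ?_, normalDeg_le_two (hle ω I) hI⟩
  · by_contra hc
    exact hI ((hfam.regular ω I).support α β hc)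
  · rintro rfl
    exact hI (projR_eq_self_iff.mp (hproj ω I) α)

/-- The conclusion for frequency sets on which the divisors of all the relevant monomials are bounded
from below. -/
theorem lieInv_mem_of_divisor_bound (hγ : 0 < γ) (hK : 0 ≤ K)
    (hdiv : ∀ α β, IsRelevant S α β → ∃ m : ℝ, 0 < m ∧
      (∀ ω ∈ O, m ≤ |freqDot ω (midxDiff α β)|) ∧
      ∀ j, β j ≠ 0 → 1 / m + γ * (lOne (midxDiff α β) / m ^ 2) ≤
        K * Real.exp (δ * (logWeight (α + β) - 2 * Real.log (jj j))))
    (hH : H ∈ HamLeZeroR S R γ r p) :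
    lieInv O A H ∈ HamLeZeroR S R γ r (p + δ) ∧
      famNorm γ r (p + δ) (lieInv O A H) ≤ ENNReal.ofReal K * famNorm γ r p H ∧
      lieD O A (lieInv O A H) = H ∧ lieInv O A (lieD O A H) = H := by
  have hcoeff : ∀ α β, IsLimFinDep 𝕜 γ (lieInv O A H α β) := by
    intro α β
    rw [lieInv_apply]
    -- Coefficients of irrelevant monomials vanish identically; there the divisor may be zero and
    -- has no lower bound.
    by_cases h0 : H α β = 0
    · have := hH.1.coeff α β
      rw [h0] at this ⊢
      simp only [Pi.zero_apply, mul_zero]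
      exact this
    obtain ⟨m, hm, hO, -⟩ := hdiv α β (HamLeZeroR.relevant_of_ne_zero hH h0)
    exact (hH.1.coeff α β).mul (continuous_divisorInv hm hO) (divisorInv_finDep O _)
      ENNReal.ofReal_ne_top ENNReal.ofReal_ne_top (enorm_divisorInv_le hm hO)
      (enorm_divisorInv_sub_le hm hO)
  have hlip : ∀ α β j, β j ≠ 0 → (lipNorm γ (lieInv O A H α β)).toReal ≤
      K * Real.exp (δ * (logWeight (α + β) - 2 * Real.log (jj j))) *
        (lipNorm γ (H α β)).toReal := by
    intro α β j hj
    by_cases h0 : H α β = 0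
    · have : lieInv O A H α β = 0 := by
        rw [lieInv_apply, h0]
        funext ω I
        simp
      rw [this, h0]
      simp [lipNorm]
    obtain ⟨m, hm, hO, hb⟩ := hdiv α β (HamLeZeroR.relevant_of_ne_zero hH h0)
    have hL : 0 ≤ lOne (midxDiff α β) := Finset.sum_nonneg fun _ _ => abs_nonneg _
    have h1 : lipNorm γ (lieInv O A H α β) ≤
        ENNReal.ofReal (1 / m + γ * (lOne (midxDiff α β) / m ^ 2)) * lipNorm γ (H α β) := by
      rw [lieInv_apply, ENNReal.ofReal_add (by positivity) (by positivity),
        ENNReal.ofReal_mul hγ.le]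
      exact lipNorm_mul_le (enorm_divisorInv_le hm hO) (enorm_divisorInv_sub_le hm hO) _
    have h2 := ENNReal.toReal_mono
      (ENNReal.mul_ne_top ENNReal.ofReal_ne_top (hH.1.coeff α β).1.finite.ne) h1
    rw [ENNReal.toReal_mul, ENNReal.toReal_ofReal (by positivity)] at h2
    exact h2.trans (mul_le_mul_of_nonneg_right (hb j hj) ENNReal.toReal_nonneg)
  have hnorm : famNorm γ r (p + δ) (lieInv O A H) ≤ ENNReal.ofReal K * famNorm γ r p H := by
    refine hamNorm_le_of_norm_le hK (fun α β j hj => ?_) hH.1.finite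
    rw [Complex.norm_real, Complex.norm_real, Real.norm_of_nonneg ENNReal.toReal_nonneg,
      Real.norm_of_nonneg ENNReal.toReal_nonneg]
    exact hlip α β j hj
  have hne : ∀ α β (ω : O) (I : A), H α β ω I ≠ 0 → (freqDot ω.1 (midxDiff α β) : ℂ) ≠ 0 := by
    intro α β ω I h0
    obtain ⟨m, hm, hO, -⟩ := hdiv α β (HamLeZeroR.relevant_of_ne_zero hH (fun h => h0 (by rw [h]; rfl)))
    exact_mod_cast abs_pos.mp (hm.trans_le (hO ω.1 ω.2))
  refine ⟨⟨⟨fun ω I => ⟨fun α β hc => ?_, ?_⟩, fun ω I hI α β => ?_, hcoeff, ?_⟩, fun ω I => ?_,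
    fun ω I => ?_⟩, hnorm, ?_, ?_⟩
  · have := (hH.1.regular ω I).support α β hc
    simp only [lieInv_apply]
    rw [this, mul_zero]
  -- At fixed `(ω, I)` a coefficient is dominated by its Lipschitz norm, so regularity follows from
  -- the family norm of `H`.
  · refine (hamNorm_le_of_norm_le (g := fun α β => ((lipNorm γ (H α β)).toReal : ℂ)) hK
      (fun α β j hj => ?_) hH.1.finite).trans_lt
      (ENNReal.mul_lt_top ENNReal.ofReal_lt_top hH.1.finite)
    rw [Complex.norm_real, Real.norm_of_nonneg ENNReal.toReal_nonneg]
    refine le_trans ?_ (hlip α β j hj)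
    have h1 := ENNReal.toReal_mono (hcoeff α β).1.finite.ne
      (enorm_le_lipNorm (γ := γ) (lieInv O A H α β) ω I)
    rwa [toReal_enorm] at h1
  -- Exchanging `α` and `β` changes the sign of the divisor, and conjugation changes the sign of
  -- `i`.
  · have h1 := hH.1.real ω I hI α β
    dsimp only at h1
    simp only [lieInv_apply]
    rw [h1, midxDiff_swap α β]
    simp only [divisorInv, freqDot_neg, map_mul, map_div₀, map_neg, Complex.conj_I,
      Complex.conj_ofReal, Complex.ofReal_neg]
    rw [neg_div_neg_eq, neg_neg]
  · exact hnorm.trans_lt (ENNReal.mul_lt_top ENNReal.ofReal_lt_top hH.1.finite)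
  · simp only [lieInv_apply]
    rw [projLeZero_mul (fun l => divisorInv O l ω), hH.2.1 ω I]
  · rw [projR_eq_self_iff]
    intro α
    have := projR_eq_self_iff.mp (hH.2.2 ω I) α
    simp only [lieInv_apply]
    rw [this, mul_zero]
  · funext α β ω I
    simp only [lieD, lieInv, LinearMap.coe_mk, AddHom.coe_mk]
    by_cases h0 : H α β ω I = 0
    · simp [h0]
    have h1 := hne α β ω I h0
    field_simp
    linear_combination -Complex.I_sq
  · funext α β ω I
    simp only [lieD, lieInv, LinearMap.coe_mk, AddHom.coe_mk]
    by_cases h0 : H α β ω I = 0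
    · simp [h0]
    have h1 := hne α β ω I h0
    field_simp
    linear_combination -Complex.I_sq

end Homological

theorem proposition6p1 (istar : ℝ) (_h_istar : 21 ≤ istar) (N₀ M₀ : ℕ) :
    ∃ c : ℝ, 0 < c ∧
      ∀ (η : ℝ) (S₀ : Finset ℤ) (idx : ℤ → ℕ) (S : Set ℤ),
        IsAdmissible istar η S₀ idx S → S₀.card ≤ N₀ → (∀ j ∈ S₀, idx j ≤ M₀) →
      ∀ γ r p δ : ℝ, 0 < γ → 0 < r → 1 < p → 0 < δ → δ < 1 →
        (∀ H : HamFamily (dioph γ S idx) (actionsReal S p r),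
          H ∈ HamLeZeroR S Set.univ γ r p →
            lieInv _ _ H ∈ HamLeZeroR S Set.univ γ r (p + δ) ∧
            famNorm γ r (p + δ) (lieInv _ _ H) ≤
              ENNReal.ofReal (1 / γ * Real.exp (Real.exp (c / δ ^ (1 / η)))) * famNorm γ r p H ∧
            lieD _ _ (lieInv _ _ H) = H ∧ lieInv _ _ (lieD _ _ H) = H) ∧
        (∀ H : HamFamily (dioph γ S idx) (actionsComplex S p r),
          H ∈ HamLeZeroR S (realPoints S p r) γ r p →
            lieInv _ _ H ∈ HamLeZeroR S (realPoints S p r) γ r (p + δ) ∧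
            famNorm γ r (p + δ) (lieInv _ _ H) ≤
              ENNReal.ofReal (1 / γ * Real.exp (Real.exp (c / δ ^ (1 / η)))) * famNorm γ r p H ∧
            lieD _ _ (lieInv _ _ H) = H ∧ lieInv _ _ (lieD _ _ H) = H) := by
  -- The `γ`-bound term in `D` serves the large-energy regime. The resulting divisor bound concerns
  -- frequencies only, hence covers real and complex actions alike.
  obtain ⟨c, hc, hle⟩ := exists_constant istar _h_istar N₀ M₀
    (3 + gammaBound istar M₀ * (2 + 4 * gammaBound istar M₀)) (by unfold gammaBound; positivity)
  refine ⟨c, hc, fun η S₀ idx S hadm hN₀ hM₀ γ r p δ hγ _ _ hδ hδ1 => ?_⟩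
  have hX := hle η δ hadm.eta_mem.1 hadm.eta_mem.2 hδ hδ1
  have hK : 0 ≤ 1 / γ * Real.exp (Real.exp (c / δ ^ (1 / η))) := by positivity
  have hdiv := fun α β (hr : IsRelevant S α β) =>
    hadm.exists_divisor_bound hN₀ hM₀ hγ hδ hδ1 hX hr
  exact ⟨fun H hH => lieInv_mem_of_divisor_bound hγ hK hdiv hH,
    fun H hH => lieInv_mem_of_divisor_bound hγ hK hdiv hH⟩
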